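/- Let $k$ be any field, $A=k[T]$, $\pi=T^{-1}$, $\mathcal{O}_\infty=k[[\pi]]$ and $K_\infty=k((\pi))$, so that $A\subset K_\infty$. Let $V$ be a vector space of finite dimension $d$ over $K_\infty$. For $R=A$ or $R=\mathcal{O}_\infty$, an $R$-lattice in $V$ is an $R$-submodule of $V$ generated over $R$ by a $K_\infty$-basis of $V$. On $\mathbb{P}^1_k=\mathrm{Proj}\,k[X_0,X_1]$ put $T=X_1/X_0$, so that $\mathrm{Spec}\,A$ is the open set $X_0\neq 0$ and $\infty$ is the point $X_0=0$. A vector bundle $\mathcal{E}$ of rank $d$ on $\mathbb{P}^1_k$ (a locally free sheaf of rank $d$) is associated with the pair $(\Lambda,\Lambda_\infty)$ of an $A$-lattice and an $\mathcal{O}_\infty$-lattice in $V$ if the generic stalk $\mathcal{E}_\eta$ embeds into $V$, linearly over $k(T)\subset K_\infty$, in such a way that $\Lambda$ is the image of $\mathcal{E}(\mathrm{Spec}\,A)$ and $\Lambda_\infty$ is the $\mathcal{O}_\infty$-submodule generated by the image of the stalk $\mathcal{E}_\infty$ (that is, $\Lambda_\infty\cong\mathcal{O}_\infty\otimes\mathcal{E}_\infty$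 is the completed stalk at $\infty$). (1) Let $\Lambda$ be an $A$-lattice and $\Lambda_\infty$ an $\mathcal{O}_\infty$-lattice in $V$. Then there are an $\mathcal{O}_\infty$-basis $v_1,\dots,v_d$ of $\Lambda_\infty$ and integers $n_1,\dots,n_d$ such that $\pi^{n_1}v_1,\dots,\pi^{n_d}v_d$ is an $A$-basis of $\Lambda$, and the integers $n_1,\dots,n_d$ are unique up to order. There is a vector bundle of rank $d$ on $\mathbb{P}^1_k$ associated with $(\Lambda,\Lambda_\infty)$, and every such bundle $\mathcal{E}$ splits as $$\mathcal{E}\cong\mathcal{O}(n_1)\oplus\cdots\oplus\mathcal{O}(n_d)$$ with these integers $n_1,\dots,n_d$. (2) Every vector bundle $\mathcal{E}$ of rank $d$ on $\mathbb{P}^1_k$ is associated with a pair of lattices in $K_\infty^d$; consequently (Grothendieck's theorem) there are integers $n_1,\dots,n_d$ with $\mathcal{E}\cong\mathcal{O}(n_1)\oplus\cdots\oplus\mathcal{O}(n_d)$. -/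

import Mathlib

open CategoryTheory CategoryTheory.Limits AlgebraicGeometry TopologicalSpace Opposite

universe u v

noncomputable section

namespace SplitP1

section Lattices

variable (k : Type u) [Field k]

/-- The uniformizer `π` of `K_∞ = k((π))`. -/
def unif : LaurentSeries k := HahnSeries.single (1 : ℤ) (1 : k)

/-- The variable `T = π⁻¹` as an element of `K_∞`. -/
def varT : LaurentSeries k := (unif k)⁻¹

/-- The polynomial ring `A = k[T]`, as a subring of `K_∞ = k((1/T))`. -/
def polyRing : Subring (LaurentSeries k) :=
  (Polynomial.eval₂RingHom (HahnSeries.C : k →+* LaurentSeries k) (varT k)).range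

/-- The ring `𝒪_∞ = k[[π]]` of power series, as a subring of `K_∞ = k((π))`. -/
def intRing : Subring (LaurentSeries k) :=
  (HahnSeries.ofPowerSeries ℤ k).range

variable {k} {V : Type v} [AddCommGroup V] [Module (LaurentSeries k) V]

/-- For a subring `R` of `K_∞` (we use `R = A` and `R = 𝒪_∞`), an `R`-submodule of the
`K_∞`-vector space `V` is an `R`-lattice if it is the `R`-span of a `K_∞`-basis of `V`. -/
def IsLattice {R : Subring (LaurentSeries k)} (L : Submodule R V) : Prop :=
  ∃ b : Module.Basis (Fin (Module.finrank (LaurentSeries k) V)) (LaurentSeries k) V,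
    L = Submodule.span R (Set.range b)

/-- The family `b` is a basis of the `R`-module `L ⊆ V`. -/
def IsBasisOf {R : Subring (LaurentSeries k)} (L : Submodule R V) {ι : Type*} (b : ι → V) :
    Prop :=
  LinearIndependent R b ∧ Submodule.span R (Set.range b) = L

/-- `v₁, …, v_d` is an `𝒪_∞`-basis of `M` and `π^{n₁} v₁, …, π^{n_d} v_d` is an `A`-basis
of `L`. -/
def IsAdapted (L : Submodule (polyRing k) V) (M : Submodule (intRing k) V) {d : ℕ}
    (v : Fin d → V) (n : Fin d → ℤ) : Prop :=
  IsBasisOf M v ∧ IsBasisOf L (fun i => (unif k ^ n i) • v i)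

end Lattices

section ProjectiveLine

variable (k : Type u) [Field k]

/-- The homogeneous coordinate ring `k[X₀, X₁]`. -/
abbrev Coord : Type u := MvPolynomial (Fin 2) k

/-- The grading of `k[X₀, X₁]` by degree. -/
abbrev grading : ℕ → Submodule k (Coord k) := MvPolynomial.homogeneousSubmodule (Fin 2) k

instance : GradedAlgebra (grading k) := MvPolynomial.gradedAlgebra

/-- The projective line `ℙ¹` over `k`. -/
abbrev P1 : Scheme.{u} := Proj (grading k)

variable {k}

/-- The local ring (not just its degree zero part) of `k[X₀, X₁]` at the homogeneous prime
ideal of a point of `ℙ¹`. -/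
abbrev HLoc (x : ProjectiveSpectrum (grading k)) : Type u :=
  Localization.AtPrime x.asHomogeneousIdeal.toIdeal

/-- The complement of the homogeneous prime ideal of a point, as a submonoid. -/
abbrev primeCompl (x : ProjectiveSpectrum (grading k)) : Submonoid (Coord k) :=
  x.asHomogeneousIdeal.toIdeal.primeCompl

/-- `f` is given on all of `U` by one fraction `r / s` of homogeneous elements with
`deg r = deg s + n`. -/
def IsTwistFraction (n : ℤ) {U : Opens (ProjectiveSpectrum.top (grading k))}
    (f : ∀ x : U, HLoc x.1) : Prop :=
  ∃ (i j : ℕ) (r s : Coord k), (i : ℤ) = j + n ∧ r ∈ grading k i ∧ s ∈ grading k j ∧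
    ∃ hs : ∀ x : U, s ∉ x.1.asHomogeneousIdeal,
      ∀ x : U, f x = Localization.mk r ⟨s, hs x⟩

/-- Being given locally by fractions of degree `n`. -/
def isLocallyTwistFraction (k : Type u) [Field k] (n : ℤ) :
    TopCat.LocalPredicate fun x : ProjectiveSpectrum.top (grading k) => HLoc x :=
  TopCat.PrelocalPredicate.sheafify
    { pred := fun f => IsTwistFraction n f
      res := by
        rintro V U i f ⟨a, b, r, s, h, hr, hs, hn, w⟩
        exact ⟨a, b, r, s, h, hr, hs, fun x => hn (i x), fun x => w (i x)⟩ }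


/-- At every point of `ℙ¹` some homogeneous element of any prescribed degree is nonzero. -/
theorem exists_notMem (x : ProjectiveSpectrum (grading k)) (m : ℕ) :
    ∃ s ∈ grading k m, s ∉ x.asHomogeneousIdeal := by
  have h : ∃ i : Fin 2, (MvPolynomial.X i : Coord k) ∉ x.asHomogeneousIdeal := by
    by_contra! h
    apply x.not_irrelevant_le
    have hx : Ideal.span (MvPolynomial.X '' (Set.univ : Set (Fin 2))) ≤
        x.asHomogeneousIdeal.toIdeal := by
      rw [Ideal.span_le]
      rintro _ ⟨i, -, rfl⟩
      exact h i
    have h0 : (HomogeneousIdeal.irrelevant (grading k)).toIdeal ≤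
        x.asHomogeneousIdeal.toIdeal := by
      rw [HomogeneousIdeal.irrelevant_eq_span, Ideal.span_le]
      intro f hf
      simp only [Set.mem_iUnion] at hf
      obtain ⟨i, hi, hf⟩ := hf
      refine hx (MvPolynomial.mem_ideal_span_X_image.2 fun m hm => ?_)
      by_contra! hc
      have hm0 : m = 0 := Finsupp.ext fun j => hc j (Set.mem_univ j)
      have h1 : MvPolynomial.IsHomogeneous f i := hf
      have h2 := h1 (MvPolynomial.mem_support_iff.1 hm)
      rw [hm0, map_zero] at h2
      omega
    exact h0
  obtain ⟨i, hi⟩ := h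
  refine ⟨MvPolynomial.X i ^ m, ?_, fun h => hi (x.isPrime.mem_of_pow_mem m h)⟩
  simpa using (MvPolynomial.isHomogeneous_X k i).pow m

/-- The ring of sections of the structure sheaf over `U`, as a ring of families of homogeneous
fractions of degree zero. -/
abbrev funSections (U : Opens (ProjectiveSpectrum.top (grading k))) :=
  ProjectiveSpectrum.StructureSheaf.sectionsSubring (𝒜 := grading k) (op U)

/-- The sections over `U` of `𝒪(n)`: families of elements of the local rings that are locally
homogeneous fractions of degree `n`. Functions act by pointwise multiplication. -/
def twistSections (n : ℤ) (U : Opens (ProjectiveSpectrum.top (grading k))) :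
    Submodule (funSections U) (∀ x : U, HLoc x.1) where
  carrier := {f | (isLocallyTwistFraction k n).pred f}
  zero_mem' := by
    intro x
    obtain ⟨s, hs, hsx⟩ := exists_notMem x.1 n.natAbs
    refine ⟨U ⊓ ProjectiveSpectrum.basicOpen (grading k) s, ⟨x.2, hsx⟩, homOfLE inf_le_left,
      (n.natAbs + n).toNat, n.natAbs, 0, s, by omega, zero_mem _, hs, fun y => y.2.2, fun y => ?_⟩
    exact (Localization.mk_zero _).symm
  add_mem' := by
    rintro a b ha hb x
    obtain ⟨Va, ma, ia, na, da, ra, sa, ea, hra, hsa, hwa, wa⟩ := ha x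
    obtain ⟨Vb, mb, ib, nb, db, rb, sb, eb, hrb, hsb, hwb, wb⟩ := hb x
    refine ⟨Va ⊓ Vb, ⟨ma, mb⟩, Opens.infLELeft _ _ ≫ ia, na + db, da + db,
      sa * rb + sb * ra, sa * sb, by push_cast; omega, add_mem ?_ ?_,
      SetLike.mul_mem_graded hsa hsb, fun y =>
        (primeCompl y.1).mul_mem (hwa ⟨y.1, y.2.1⟩) (hwb ⟨y.1, y.2.2⟩),
      fun y => ?_⟩
    · have : na + db = da + nb := by omega
      rw [this]
      exact SetLike.mul_mem_graded hsa hrb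
    · rw [add_comm na db]
      exact SetLike.mul_mem_graded hsb hra
    · have h1 := wa ⟨y.1, y.2.1⟩
      have h2 := wb ⟨y.1, y.2.2⟩
      exact (congrArg₂ (· + ·) h1 h2).trans (Localization.add_mk _ _ _ _)
  smul_mem' := by
    rintro c b hc x
    obtain ⟨Va, ma, ia, na, ⟨ra, hra⟩, ⟨sa, hsa⟩, hwa, wa⟩ := c.2 x
    obtain ⟨Vb, mb, ib, nb, db, rb, sb, eb, hrb, hsb, hwb, wb⟩ := hc x
    refine ⟨Va ⊓ Vb, ⟨ma, mb⟩, Opens.infLELeft _ _ ≫ ia, na + nb, na + db,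
      ra * rb, sa * sb, by push_cast; omega, SetLike.mul_mem_graded hra hrb,
      SetLike.mul_mem_graded hsa hsb, fun y =>
        (primeCompl y.1).mul_mem (hwa ⟨y.1, y.2.1⟩) (hwb ⟨y.1, y.2.2⟩),
      fun y => ?_⟩
    have h1 := congrArg HomogeneousLocalization.val (wa ⟨y.1, y.2.1⟩)
    have h2 := wb ⟨y.1, y.2.2⟩
    exact (congrArg₂ (· * ·) h1 h2).trans (Localization.mk_mul _ _ _ _)

instance (n : ℤ) (U : (Opens (ProjectiveSpectrum.top (grading k)))ᵒᵖ) :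
    Module ((P1 k).ringCatSheaf.obj.obj U) (twistSections (k := k) n U.unop) :=
  inferInstanceAs (Module (funSections U.unop) (twistSections (k := k) n U.unop))

/-- The presheaf of abelian groups underlying `𝒪(n)`. -/
def twistAb (k : Type u) [Field k] (n : ℤ) : (P1 k).Opensᵒᵖ ⥤ Ab.{u} where
  obj U := .of (twistSections (k := k) n U.unop)
  map {U W} i := AddCommGrpCat.ofHom
    { toFun := fun s => ⟨fun x => s.1 (i.unop x), (isLocallyTwistFraction k n).res i.unop _ s.2⟩
      map_zero' := rfl
      map_add' := fun _ _ => rfl }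

instance (n : ℤ) (U : (P1 k).Opensᵒᵖ) :
    Module ((P1 k).ringCatSheaf.obj.obj U) ((twistAb k n).obj U) :=
  inferInstanceAs (Module (funSections U.unop) (twistSections (k := k) n U.unop))

/-- The twisting sheaf `𝒪(n)` on `ℙ¹`. -/
def twist (k : Type u) [Field k] (n : ℤ) : (P1 k).Modules where
  val := .ofPresheaf (R := (P1 k).ringCatSheaf.obj) (twistAb k n) fun _ _ _ _ _ => rfl
  isSheaf := (TopCat.Presheaf.isSheaf_iff_isSheaf_comp (forget AddCommGrpCat) _).2
    (TopCat.subsheafToTypes (isLocallyTwistFraction k n)).2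

/-- A vector bundle of rank `d` on `ℙ¹`: a sheaf of modules that is isomorphic to the free sheaf
of rank `d` on each member of some open covering. -/
def IsVectorBundle (d : ℕ) (E : (P1 k).Modules) : Prop :=
  ∃ q : SheafOfModules.LocalGeneratorsData.{u} (R := (P1 k).ringCatSheaf) E,
    q.IsLocallyFreeData ∧ ∀ i, Finite (q.generators i).I ∧ Nat.card (q.generators i).I = d

variable (k) in
/-- The generic point of `ℙ¹`, i.e. the zero ideal. -/
def genPt : P1 k :=
  (⟨⊥, by
    change (⊥ : Ideal (Coord k)).IsPrime
    exact Ideal.isPrime_bot, fun h => by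
    have h1 : (MvPolynomial.X 0 : Coord k) ∈ HomogeneousIdeal.irrelevant (grading k) :=
      HomogeneousIdeal.mem_irrelevant_of_mem _ one_pos (MvPolynomial.isHomogeneous_X k 0)
    have h2 : (MvPolynomial.X 0 : Coord k) ∈ (⊥ : Ideal (Coord k)) := h h1
    exact MvPolynomial.X_ne_zero _ h2⟩ : ProjectiveSpectrum (grading k))

variable (k) in
/-- The point `∞` of `ℙ¹`, where `X₀ = 0`. -/
def inftyPt : P1 k :=
  (⟨⟨Ideal.span {MvPolynomial.X 0}, Ideal.homogeneous_span _ _ (by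
      rintro _ rfl
      exact ⟨1, MvPolynomial.isHomogeneous_X k 0⟩)⟩,
    (Ideal.span_singleton_prime (MvPolynomial.X_ne_zero _)).2 (MvPolynomial.X_prime),
    fun h => by
    have h1 : (MvPolynomial.X 1 : Coord k) ∈ HomogeneousIdeal.irrelevant (grading k) :=
      HomogeneousIdeal.mem_irrelevant_of_mem _ one_pos (MvPolynomial.isHomogeneous_X k 1)
    have h2 : (MvPolynomial.X 1 : Coord k) ∈ Ideal.span {(MvPolynomial.X 0 : Coord k)} := h h1
    rw [Ideal.mem_span_singleton, MvPolynomial.X_dvd_X] at h2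
    simp at h2⟩ : ProjectiveSpectrum (grading k))

variable (k) in
/-- The affine chart `X₀ ≠ 0` of `ℙ¹`, that is `Spec k[T]` with `T = X₁ / X₀`. -/
def finChart : (P1 k).Opens := Proj.basicOpen (grading k) (MvPolynomial.X 0)

/-- Evaluation of a form at `X₀ = 1`, `X₁ = T`. -/
def evalForm (k : Type u) [Field k] : Coord k →+* LaurentSeries k :=
  MvPolynomial.eval₂Hom HahnSeries.C ![1, varT k]

theorem evalForm_ne_zero {m : ℕ} {s : Coord k} (hs : s ∈ grading k m) (h0 : s ≠ 0) :
    evalForm k s ≠ 0 := by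
  obtain ⟨e, he⟩ := MvPolynomial.ne_zero_iff.1 h0
  have hdeg : ∀ d : Fin 2 →₀ ℕ, s.coeff d ≠ 0 → d 0 + d 1 = m := by
    intro d hd
    have h1 : MvPolynomial.IsHomogeneous s m := hs
    have h2 := h1 hd
    simpa [Finsupp.weight_apply, Finsupp.sum_fintype, Fin.sum_univ_two] using h2
  have hT : ∀ j : ℕ, varT k ^ j = HahnSeries.single (-(j : ℤ)) (1 : k) := by
    intro j
    simp [varT, unif, HahnSeries.single_pow]
  intro h
  have h3 : (evalForm k s).coeff (-(e 1 : ℤ)) = s.coeff e := by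
    rw [evalForm, MvPolynomial.coe_eval₂Hom, MvPolynomial.eval₂_eq', HahnSeries.coeff_sum,
      Finset.sum_eq_single e]
    · simp [Fin.prod_univ_two, hT]
    · intro d hd hde
      have hd0 := MvPolynomial.mem_support_iff.1 hd
      have hne : d 1 ≠ e 1 := by
        intro h1
        apply hde
        have ha := hdeg d hd0
        have hb := hdeg e he
        ext i
        fin_cases i
        · simp
          omega
        · simpa using h1
      have hne' : (-(e 1 : ℤ)) ≠ -(d 1 : ℤ) := by omega
      simp [Fin.prod_univ_two, hT, HahnSeries.coeff_single_of_ne hne']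
    · intro hd
      simp [MvPolynomial.notMem_support_iff.1 hd]
  apply he
  rw [← h3, h, HahnSeries.coeff_zero]

theorem evalForm_den_ne_zero {x : ProjectiveSpectrum (grading k)}
    (c : HomogeneousLocalization.NumDenSameDeg (grading k) (primeCompl x)) :
    evalForm k c.den ≠ 0 :=
  evalForm_ne_zero c.den.2 fun h => c.den_mem (by rw [h]; exact zero_mem _)

/-- The expansion at `∞` of a homogeneous fraction `r / s` of degree zero, i.e. of the rational
function `r(1, T) / s(1, T) ∈ k(T)`, as an element of `K_∞ = k((1/T))`. -/
def expandFrac (x : ProjectiveSpectrum (grading k)) :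
    HomogeneousLocalization.AtPrime (grading k) x.asHomogeneousIdeal.toIdeal →+*
      LaurentSeries k where
  toFun := Quotient.lift (fun c => evalForm k c.num / evalForm k c.den) (by
    intro c c' h
    have h1 : Localization.mk (c.num : Coord k) (⟨c.den, c.den_mem⟩ : primeCompl x) =
      Localization.mk (c'.num : Coord k) (⟨c'.den, c'.den_mem⟩ : primeCompl x) := h
    rw [Localization.mk_eq_mk_iff, Localization.r_iff_exists] at h1
    obtain ⟨u, hu⟩ := h1
    have hu0 : (u : Coord k) ≠ 0 := fun h0 => u.2 (by rw [h0]; exact zero_mem _)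
    have h2 : (c'.den : Coord k) * c.num = c.den * c'.num := mul_left_cancel₀ hu0 hu
    have h3 := congrArg (evalForm k) h2
    rw [map_mul, map_mul] at h3
    rw [div_eq_div_iff (evalForm_den_ne_zero c) (evalForm_den_ne_zero c')]
    linear_combination h3)
  map_one' := by
    change evalForm k 1 / evalForm k 1 = 1
    simp
  map_mul' := by
    rintro ⟨c⟩ ⟨c'⟩
    change evalForm k (c.num * c'.num) / evalForm k (c.den * c'.den) =
      (evalForm k c.num / evalForm k c.den) * (evalForm k c'.num / evalForm k c'.den)
    rw [map_mul, map_mul, div_mul_div_comm]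
  map_zero' := by
    change evalForm k 0 / evalForm k 1 = 0
    simp
  map_add' := by
    rintro ⟨c⟩ ⟨c'⟩
    change evalForm k (c.den * c'.num + c'.den * c.num) / evalForm k (c.den * c'.den) =
      (evalForm k c.num / evalForm k c.den) + (evalForm k c'.num / evalForm k c'.den)
    rw [map_add, map_mul, map_mul, map_mul,
      div_add_div _ _ (evalForm_den_ne_zero c) (evalForm_den_ne_zero c')]
    ring

/-- The expansion at `∞` in `K_∞` of a regular function on an open set `U ≠ ∅` of `ℙ¹`. -/
def expand (U : (P1 k).Opens) (hU : genPt k ∈ U) : Γ(P1 k, U) →+* LaurentSeries k where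
  toFun f := expandFrac (genPt k) (f.1 ⟨genPt k, hU⟩)
  map_one' := map_one (expandFrac (genPt k))
  map_mul' _ _ := map_mul (expandFrac (genPt k)) _ _
  map_zero' := map_zero (expandFrac (genPt k))
  map_add' _ _ := map_add (expandFrac (genPt k)) _ _

theorem genPt_mem (U : (P1 k).Opens) (x : P1 k) (hx : x ∈ U) : genPt k ∈ U := by
  obtain ⟨_, ⟨f, rfl⟩, hf, hU⟩ :=
    (ProjectiveSpectrum.isTopologicalBasis_basic_opens (grading k)).exists_subset_of_mem_open hx U.2
  refine hU (fun h => hf ?_)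
  have h0 : f = 0 := h
  rw [h0]
  exact zero_mem _

theorem genPt_specializes (x : P1 k) : genPt k ⤳ x :=
  specializes_iff_forall_open.2 fun U hU hx => genPt_mem ⟨U, hU⟩ x hx

theorem genPt_mem_finChart : genPt k ∈ finChart k := fun h => by
  have h2 : (MvPolynomial.X 0 : Coord k) ∈ (⊥ : Ideal (Coord k)) := h
  exact MvPolynomial.X_ne_zero _ h2

/-- The direct sum `𝒪(n₁) ⊕ ⋯ ⊕ 𝒪(n_d)`. -/
def sumTwist (k : Type u) [Field k] {d : ℕ} (n : Fin d → ℤ) : (P1 k).Modules :=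
  haveI : HasFiniteBiproducts (P1 k).Modules := Abelian.hasFiniteBiproducts
  ⨁ fun i : Fin d => twist k (n i)

variable {V : Type v} [AddCommGroup V] [Module (LaurentSeries k) V]

/-- The vector bundle `E` on `ℙ¹` is associated with the lattices `L` (over `A`) and `M` (over
`𝒪_∞`) in the `d`-dimensional space `V`: it has rank `d`, and its generic stalk embeds,
compatibly with `k(T) ⊆ K_∞`, into `V` in such a way that `L` is the module of sections over
`Spec A`, and `M` is the completed stalk at `∞`, i.e. the `𝒪_∞`-module generated by the stalk
`E_∞` (the completion of the free module `E_∞` of finite rank is `𝒪_∞ ⊗ E_∞`; if `M` is a lattice,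
then `𝒪_∞ ⊗ E_∞ → M` and `K_∞ ⊗ E_η → V` are surjections between free modules of rank `d`,
hence isomorphisms). -/
def IsAssociated (E : (P1 k).Modules) (L : Submodule (polyRing k) V)
    (M : Submodule (intRing k) V) : Prop :=
  IsVectorBundle (Module.finrank (LaurentSeries k) V) E ∧
  ∃ θ : E.presheaf.stalk (genPt k) →+ V, Function.Injective θ ∧
    (∀ (U : (P1 k).Opens) (hU : genPt k ∈ U) (f : Γ(P1 k, U)) (s : Γ(E, U)),
      θ (E.presheaf.germ U _ hU (f • s)) = expand U hU f • θ (E.presheaf.germ U _ hU s)) ∧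
    (L : Set V) =
      Set.range (fun s : Γ(E, finChart k) => θ (E.presheaf.germ _ _ genPt_mem_finChart s)) ∧
    M = Submodule.span (intRing k) (Set.range (fun t : E.presheaf.stalk (inftyPt k) =>
      θ (E.presheaf.stalkSpecializes (genPt_specializes (inftyPt k)) t)))

end ProjectiveLine

end SplitP1

end

/-!
Why the theorem is true.

*Adapted bases.* Take a basis of `Λ` over `A` and write its vectors as `π ^ nᵢ` times vectors with
coordinates in `k[[π]]` with respect to a basis of `Λ_∞`. If the coordinate matrix `U` is not
invertible over `k[[π]]`, then its rows are dependent modulo `π`. Multiplying such a relation by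
suitable powers of `T = π⁻¹` gives an elementary operation over `k[T]` on the basis of `Λ` that
makes one row divisible by `π`, and the order of `det U` drops (`exists_isAdapted_of_matrix`). The
`nᵢ` are unique because the transition matrix between two adapted bases has entries that are
polynomials in `T` and also `π ^ (n'ⱼ - nᵢ)` times power series in `π`; they vanish whenever
`nᵢ < n'ⱼ`, while some term of the determinant does not vanish (`exists_perm_le`).

*Bundles and lattices.* Freeness on an open set is expressed by a basis of sections
(`IsLocalBasis`), and sections are compared through their values in `V` at the generic point
(`genVal`). Sections of a bundle over the affine chart and its completed stalk at `∞` determine all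
sections: away from `∞` a section extends to the chart after multiplication by a power of a
function (`exists_genVal_eq_pow_smul`), and near `∞` its coordinates in a local basis are rational
functions that lie in `k[[π]]`, hence regular functions (`exists_expand_eq`). So two bundles
associated with the same pair of lattices are isomorphic (`IsAssociated.nonempty_iso`). The direct
sum of the `𝒪(nᵢ)` is associated with the pair that has the adapted basis `v` with integers `n`, by
sending `X₀ ^ nᵢ` to `π ^ nᵢ vᵢ` and therefore `X₁ ^ nᵢ` to `vᵢ`
(`IsAdapted.isAssociated_sumTwist`). Conversely a local basis at `∞` embeds the generic stalk of
any bundle into `K_∞ ^ d`; the sections over the affine chart are a finitely generated torsion-free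
module over the principal ideal domain `A`, of rank `d` (`IsVectorBundle.exists_isAssociated`).
-/

noncomputable section

namespace SplitP1

/-! ### The subrings `k[T]` and `k[[π]]` of `k((π))` -/

section Subrings

variable {k : Type u} [Field k]

theorem unif_ne_zero : unif k ≠ 0 := by
  simp [unif]

theorem varT_ne_zero : varT k ≠ 0 := inv_ne_zero unif_ne_zero

theorem ofPowerSeries_X_eq_unif : HahnSeries.ofPowerSeries ℤ k PowerSeries.X = unif k :=
  HahnSeries.ofPowerSeries_X

theorem unif_zpow (n : ℤ) : unif k ^ n = HahnSeries.single n (1 : k) := by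
  cases n with
  | ofNat n => simp [unif, HahnSeries.single_pow]
  | negSucc n =>
    rw [zpow_negSucc]
    simp [unif, HahnSeries.single_pow, Int.negSucc_eq]

theorem ofPowerSeries_mem_intRing (f : PowerSeries k) :
    HahnSeries.ofPowerSeries ℤ k f ∈ intRing k := ⟨f, rfl⟩

theorem unif_pow_mem_intRing (n : ℕ) : unif k ^ n ∈ intRing k :=
  pow_mem (ofPowerSeries_X_eq_unif (k := k) ▸ ofPowerSeries_mem_intRing _) n

theorem varT_mem_polyRing : varT k ∈ polyRing k := ⟨Polynomial.X, by simp⟩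

theorem C_mem_polyRing (a : k) : (HahnSeries.C a : LaurentSeries k) ∈ polyRing k :=
  ⟨Polynomial.C a, by simp⟩

theorem unif_zpow_mem_polyRing {n : ℤ} (hn : n ≤ 0) : unif k ^ n ∈ polyRing k := by
  obtain ⟨m, rfl⟩ := Int.exists_eq_neg_ofNat hn
  rw [zpow_neg, ← inv_zpow, zpow_natCast]
  exact pow_mem varT_mem_polyRing m

theorem coeff_eq_zero_of_mem_intRing {x : LaurentSeries k} (hx : x ∈ intRing k) {j : ℤ}
    (hj : j < 0) : x.coeff j = 0 := by
  obtain ⟨f, rfl⟩ := hx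
  rw [HahnSeries.ofPowerSeries_apply]
  apply HahnSeries.embDomain_of_notMem_range
  rintro ⟨a, ha⟩
  change ((a : ℕ) : ℤ) = j at ha
  omega

theorem coeff_eq_zero_of_mem_polyRing {x : LaurentSeries k} (hx : x ∈ polyRing k) {j : ℤ}
    (hj : 0 < j) : x.coeff j = 0 := by
  obtain ⟨p, rfl⟩ := hx
  rw [Polynomial.coe_eval₂RingHom, Polynomial.eval₂_eq_sum_range, HahnSeries.coeff_sum]
  refine Finset.sum_eq_zero fun i _ => ?_
  have : varT k ^ i = HahnSeries.single (-(i : ℤ)) (1 : k) := by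
    rw [varT, inv_pow, ← zpow_natCast, ← zpow_neg, unif_zpow]
  rw [this, HahnSeries.C_apply, HahnSeries.single_mul_single,
    HahnSeries.coeff_single_of_ne (by omega)]

/-- A polynomial in `T = π⁻¹` that vanishes at `π = 0` is zero. -/
theorem eq_zero_of_mem_polyRing {x y : LaurentSeries k} (hx : x ∈ polyRing k)
    (hy : y ∈ intRing k) {n : ℤ} (hn : 0 < n) (h : x = unif k ^ n * y) : x = 0 := by
  ext j
  rw [HahnSeries.coeff_zero]
  rcases lt_or_ge 0 j with hj | hj
  · exact coeff_eq_zero_of_mem_polyRing hx hj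
  · have h1 := HahnSeries.coeff_single_mul_add (r := (1 : k)) (x := y) (a := j - n) (b := n)
    rw [h, unif_zpow]
    rw [sub_add_cancel] at h1
    rw [h1, coeff_eq_zero_of_mem_intRing hy (by omega), mul_zero]

theorem exists_unif_pow_mul_mem_intRing (x : LaurentSeries k) :
    ∃ N : ℕ, unif k ^ N * x ∈ intRing k := by
  refine ⟨(-x.order).toNat, ?_⟩
  have h := LaurentSeries.single_order_mul_powerSeriesPart x
  rw [← unif_zpow] at h
  obtain ⟨m, hm⟩ : ∃ m : ℕ, (((-x.order).toNat : ℤ)) + x.order = m :=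
    ⟨((((-x.order).toNat : ℤ)) + x.order).toNat, by omega⟩
  generalize x.order = o at *
  rw [← h, ← mul_assoc, ← zpow_natCast, ← zpow_add₀ unif_ne_zero, hm, zpow_natCast]
  exact mul_mem (unif_pow_mem_intRing m) (ofPowerSeries_mem_intRing _)

theorem exists_unif_pow_mul_mem_intRing_of_finite {ι : Type*} [Finite ι]
    (x : ι → LaurentSeries k) : ∃ N : ℕ, ∀ i, unif k ^ N * x i ∈ intRing k := by
  cases nonempty_fintype ι
  choose N hN using fun i => exists_unif_pow_mul_mem_intRing (x i)
  refine ⟨∑ i, N i, fun i => ?_⟩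
  rw [← Nat.sub_add_cancel (Finset.single_le_sum (fun _ _ => Nat.zero_le _) (Finset.mem_univ i) :
    N i ≤ ∑ i, N i), pow_add, mul_assoc]
  exact mul_mem (unif_pow_mem_intRing _) (hN i)

end Subrings

section AdaptedBases

variable {k : Type u} [Field k] {V : Type v} [AddCommGroup V] [Module (LaurentSeries k) V]

theorem linearIndependent_subring {R : Subring (LaurentSeries k)} {ι : Type*} {b : ι → V}
    (hb : LinearIndependent (LaurentSeries k) b) : LinearIndependent R b :=
  hb.restrict_scalars fun x y h => Subtype.ext (by simpa [Subring.smul_def] using h)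

theorem linearIndependent_of_intRing {ι : Type*} [Finite ι] {b : ι → V}
    (hb : LinearIndependent (intRing k) b) : LinearIndependent (LaurentSeries k) b := by
  cases nonempty_fintype ι
  rw [Fintype.linearIndependent_iff] at hb ⊢
  intro g hg i
  obtain ⟨N, hN⟩ := exists_unif_pow_mul_mem_intRing_of_finite g
  have h := hb (fun i => ⟨_, hN i⟩) (by
    simp only [Subring.smul_def, mul_smul, ← Finset.smul_sum, hg, smul_zero]) i
  have h1 : unif k ^ N * g i = 0 := congrArg Subtype.val h
  exact (mul_eq_zero.1 h1).resolve_left (pow_ne_zero _ unif_ne_zero)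

theorem linearIndependent_unif_smul {ι : Type*} {b : ι → V}
    (hb : LinearIndependent (LaurentSeries k) b) (n : ι → ℤ) :
    LinearIndependent (LaurentSeries k) fun i => (unif k ^ n i) • b i :=
  hb.units_smul fun i => Units.mk0 (unif k ^ n i) (zpow_ne_zero _ unif_ne_zero)

theorem exists_coeff_of_mem_span {R : Subring (LaurentSeries k)} {ι : Type*} [Fintype ι]
    {b : ι → V} {x : V} (hx : x ∈ Submodule.span R (Set.range b)) :
    ∃ c : ι → LaurentSeries k, (∀ i, c i ∈ R) ∧ x = ∑ i, c i • b i := by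
  obtain ⟨c, rfl⟩ := (Submodule.mem_span_range_iff_exists_fun R).1 hx
  exact ⟨fun i => c i, fun i => (c i).2, rfl⟩

theorem sum_smul_mem {R : Subring (LaurentSeries k)} {ι : Type*} [Fintype ι] (L : Submodule R V)
    {b : ι → V} (hb : ∀ i, b i ∈ L) {c : ι → LaurentSeries k} (hc : ∀ i, c i ∈ R) :
    ∑ i, c i • b i ∈ L :=
  sum_mem fun i _ => L.smul_mem ⟨c i, hc i⟩ (hb i)

/-- The transition matrix `P` between two adapted bases has entries `π ^ (n' j - n i) * Q j i` with
`Q` integral at `∞`, so `P j i` vanishes if `n i < n' j`; a nonzero term in the Leibniz expansion of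
`det P` gives the permutation. -/
theorem exists_perm_le {L : Submodule (polyRing k) V} {M : Submodule (intRing k) V} {d : ℕ}
    {v v' : Fin d → V} {n n' : Fin d → ℤ} (h : IsAdapted L M v n) (h' : IsAdapted L M v' n') :
    ∃ σ : Equiv.Perm (Fin d), ∀ i, n' (σ i) ≤ n i := by
  have hv := linearIndependent_of_intRing h.1.1
  have hv' := linearIndependent_of_intRing h'.1.1
  have hw := linearIndependent_unif_smul hv n
  have hw' := linearIndependent_unif_smul hv' n'
  have hQ : ∀ j, ∃ c : Fin d → LaurentSeries k, (∀ i, c i ∈ intRing k) ∧ v' j = ∑ i, c i • v i :=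
    fun j => exists_coeff_of_mem_span (by
      rw [h.1.2, ← h'.1.2]; exact Submodule.subset_span ⟨j, rfl⟩)
  have hP : ∀ j, ∃ c : Fin d → LaurentSeries k, (∀ i, c i ∈ polyRing k) ∧
      unif k ^ n' j • v' j = ∑ i, c i • unif k ^ n i • v i :=
    fun j => exists_coeff_of_mem_span (b := fun i => unif k ^ n i • v i) (by
      rw [h.2.2, ← h'.2.2]; exact Submodule.subset_span ⟨j, rfl⟩)
  choose Q hQmem hQ using hQ
  choose P hPmem hP using hP
  have hPQ : ∀ j i, P j i = unif k ^ (n' j - n i) * Q j i := by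
    intro j i
    have h1 : ∑ i, (P j i * unif k ^ n i) • v i = ∑ i, (unif k ^ n' j * Q j i) • v i := by
      simp only [mul_smul, ← Finset.smul_sum]
      rw [← hQ, hP]
    have h2 := congrFun (linearIndependent_iff_injective_fintypeLinearCombination.1 hv
      (by simpa [Fintype.linearCombination_apply] using h1)) i
    rw [zpow_sub₀ unif_ne_zero, div_mul_eq_mul_div, eq_div_iff (zpow_ne_zero _ unif_ne_zero)]
    exact h2
  have hdet : (Matrix.of P).det ≠ 0 := by
    intro h0
    obtain ⟨c, hc, hc0⟩ := Matrix.exists_vecMul_eq_zero_iff.2 h0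
    apply hc
    ext1 j
    refine Fintype.linearIndependent_iff.1 hw' c ?_ j
    simp only [hP, Finset.smul_sum, ← mul_smul _ (P _ _)]
    rw [Finset.sum_comm]
    refine Finset.sum_eq_zero fun i _ => ?_
    rw [← Finset.sum_smul]
    have := congrFun hc0 i
    simp only [Matrix.vecMul, dotProduct, Matrix.of_apply, Pi.zero_apply] at this
    rw [this, zero_smul]
  rw [Matrix.det_apply] at hdet
  obtain ⟨σ, -, hσ⟩ := Finset.exists_ne_zero_of_sum_ne_zero hdet
  refine ⟨σ, fun i => ?_⟩
  by_contra! hlt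
  apply hσ
  rw [Finset.prod_eq_zero (Finset.mem_univ i), smul_zero]
  exact eq_zero_of_mem_polyRing (hPmem _ _) (hQmem _ _) (by omega) (hPQ (σ i) i)

theorem IsAdapted.exists_perm {L : Submodule (polyRing k) V} {M : Submodule (intRing k) V} {d : ℕ}
    {v v' : Fin d → V} {n n' : Fin d → ℤ} (h : IsAdapted L M v n) (h' : IsAdapted L M v' n') :
    ∃ σ : Equiv.Perm (Fin d), ∀ i, n' i = n (σ i) := by
  obtain ⟨σ, hσ⟩ := exists_perm_le h h'
  obtain ⟨τ, hτ⟩ := exists_perm_le h' h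
  have h1 : ∑ i, n' (σ i) = ∑ i, n i := le_antisymm (Finset.sum_le_sum fun i _ => hσ i) (by
    rw [Equiv.sum_comp σ n', ← Equiv.sum_comp τ n]
    exact Finset.sum_le_sum fun i _ => hτ i)
  have h2 := (Finset.sum_eq_sum_iff_of_le fun i _ => hσ i).1 h1
  exact ⟨σ.symm, fun i => by rw [← h2 _ (Finset.mem_univ _), Equiv.apply_symm_apply]⟩

/-- Reduction: as long as the vectors `π ^ (-n i) b i`, with coordinate matrix `U` in a basis of
`M`, are dependent modulo `π`, one of them can be changed by an elementary operation over `k[T]` so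
that it becomes divisible by `π`; this lowers the order of `det U`. -/
theorem exists_isAdapted_of_matrix {d : ℕ} (e : Module.Basis (Fin d) (LaurentSeries k) V)
    (L : Submodule (polyRing k) V) (N : ℕ) : ∀ (b : Fin d → V) (n : Fin d → ℤ)
    (U : Matrix (Fin d) (Fin d) (PowerSeries k)), Submodule.span (polyRing k) (Set.range b) = L →
    (∀ i, b i = unif k ^ n i • ∑ j, HahnSeries.ofPowerSeries ℤ k (U i j) • e j) →
    ¬ PowerSeries.X ^ N ∣ U.det →
    ∃ (v : Fin d → V) (n : Fin d → ℤ),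
      IsAdapted L (Submodule.span (intRing k) (Set.range e)) v n := by
  induction N with
  | zero => intro b n U _ _ h; exact absurd (by simp) h
  | succ N ih =>
    intro b n U hb hU hdet
    by_cases hu : IsUnit U.det
    · -- `U` is invertible over `k[[π]]`, so its rows form a basis of the lattice at infinity.
      refine ⟨fun i => ∑ j, HahnSeries.ofPowerSeries ℤ k (U i j) • e j, n, ?_⟩
      obtain ⟨W, hW⟩ := (Matrix.isUnit_iff_isUnit_det U).2 hu
      have hinv : ∀ i, e i = ∑ j, HahnSeries.ofPowerSeries ℤ k ((W⁻¹).1 i j) •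
          ∑ l, HahnSeries.ofPowerSeries ℤ k (U j l) • e l := by
        intro i
        simp only [Finset.smul_sum, ← mul_smul]
        rw [Finset.sum_comm]
        have h1 : (W⁻¹).1 * U = 1 := by rw [← hW]; exact W.inv_mul
        have h2 : ∀ l, ∑ j, HahnSeries.ofPowerSeries ℤ k ((W⁻¹).1 i j) *
            HahnSeries.ofPowerSeries ℤ k (U j l) = if i = l then 1 else 0 := by
          intro l
          simp only [← map_mul, ← map_sum]
          have h3 := congrFun (congrFun h1 i) l
          rw [Matrix.mul_apply, Matrix.one_apply] at h3
          rw [h3]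
          split_ifs <;> simp
        simp only [← Finset.sum_smul, h2]
        simp
      have hspan : Submodule.span (intRing k) (Set.range fun i =>
          ∑ j, HahnSeries.ofPowerSeries ℤ k (U i j) • e j) =
          Submodule.span (intRing k) (Set.range e) := by
        apply le_antisymm
        · rw [Submodule.span_le]
          rintro _ ⟨i, rfl⟩
          exact sum_smul_mem _ (fun j => Submodule.subset_span (Set.mem_range_self j))
            fun j => ofPowerSeries_mem_intRing _
        · rw [Submodule.span_le]
          rintro _ ⟨i, rfl⟩
          rw [hinv i]
          exact sum_smul_mem _ (fun j => Submodule.subset_span (Set.mem_range_self j))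
            fun j => ofPowerSeries_mem_intRing _
      have hli : LinearIndependent (LaurentSeries k) fun i =>
          ∑ j, HahnSeries.ofPowerSeries ℤ k (U i j) • e j := by
        refine linearIndependent_of_top_le_span_of_card_eq_finrank ?_
          (Module.finrank_eq_card_basis e).symm
        rw [← e.span_eq, Submodule.span_le]
        rintro _ ⟨i, rfl⟩
        rw [hinv i]
        exact sum_mem fun j _ => Submodule.smul_mem _ _ (Submodule.subset_span ⟨j, rfl⟩)
      refine ⟨⟨linearIndependent_subring hli, hspan⟩,
        linearIndependent_subring (linearIndependent_unif_smul hli n), ?_⟩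
      rw [← hb]
      congr 2
      exact funext fun i => (hU i).symm
    · classical
      rw [PowerSeries.isUnit_iff_constantCoeff, isUnit_iff_ne_zero, not_not,
        RingHom.map_det] at hu
      obtain ⟨c, hc, hc0⟩ := Matrix.exists_vecMul_eq_zero_iff.2 hu
      obtain ⟨i₁, hi₁⟩ := Function.ne_iff.1 hc
      obtain ⟨i₀, hi₀, hmin⟩ := Finset.exists_min_image (Finset.univ.filter fun i => c i ≠ 0) n
        ⟨i₁, by simpa using hi₁⟩
      simp only [Finset.mem_filter, Finset.mem_univ, true_and] at hi₀ hmin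
      -- The row `∑ c i / c i₀ • U i` is divisible by `π`.
      have hdiv : ∀ j, ∃ f : PowerSeries k,
          ∑ i, PowerSeries.C (c i / c i₀) * U i j = PowerSeries.X * f := by
        intro j
        rw [← dvd_def, PowerSeries.X_dvd_iff, map_sum]
        have h1 := congrFun hc0 j
        simp only [Matrix.vecMul, dotProduct, Pi.zero_apply, RingHom.mapMatrix_apply,
          Matrix.map_apply] at h1
        simp only [map_mul, PowerSeries.constantCoeff_C, div_mul_eq_mul_div, ← Finset.sum_div]
        rw [h1, zero_div]
      choose f hf using hdiv
      have ha : ∀ i, HahnSeries.C (c i / c i₀) * unif k ^ (n i₀ - n i) ∈ polyRing k := by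
        intro i
        by_cases h0 : c i = 0
        · rw [h0, zero_div, map_zero, zero_mul]; exact zero_mem _
        · exact mul_mem (C_mem_polyRing _)
            (unif_zpow_mem_polyRing (sub_nonpos.2 (hmin i h0)))
      set b₀ : V := ∑ i, (HahnSeries.C (c i / c i₀) * unif k ^ (n i₀ - n i)) • b i with hb₀
      have hb₀L : b₀ ∈ L := sum_smul_mem L
        (fun i => hb ▸ Submodule.subset_span ⟨i, rfl⟩) ha
      refine ih (Function.update b i₀ b₀) (Function.update n i₀ (n i₀ + 1)) (U.updateRow i₀ f)
        ?_ ?_ ?_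
      · apply le_antisymm
        · rw [Submodule.span_le]
          rintro _ ⟨i, rfl⟩
          by_cases h0 : i = i₀
          · subst h0; simpa using hb₀L
          · rw [Function.update_of_ne h0, ← hb]
            exact Submodule.subset_span ⟨i, rfl⟩
        · set S := Submodule.span (polyRing k) (Set.range (Function.update b i₀ b₀)) with hS
          have hne : ∀ i, i ≠ i₀ → b i ∈ S := fun i h0 =>
            Submodule.subset_span ⟨i, Function.update_of_ne h0 _ _⟩
          have h₀ : b i₀ ∈ S := by
            have h1 : b i₀ = b₀ - ∑ i ∈ Finset.univ.erase i₀,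
                (HahnSeries.C (c i / c i₀) * unif k ^ (n i₀ - n i)) • b i := by
              rw [hb₀, ← Finset.add_sum_erase _ _ (Finset.mem_univ i₀), div_self hi₀, sub_self,
                zpow_zero, map_one, mul_one, one_smul, add_sub_cancel_right]
            rw [h1]
            refine sub_mem (Submodule.subset_span ⟨i₀, Function.update_self ..⟩)
              (sum_mem fun i hi => ?_)
            exact S.smul_mem ⟨_, ha i⟩ (hne i (Finset.ne_of_mem_erase hi))
          rw [← hb, Submodule.span_le]
          rintro _ ⟨i, rfl⟩
          by_cases h0 : i = i₀
          · exact h0 ▸ h₀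
          · exact hne i h0
      · intro i
        by_cases h0 : i = i₀
        · subst h0
          simp only [Function.update_self, Matrix.updateRow_self]
          have hfX : ∀ l, unif k * HahnSeries.ofPowerSeries ℤ k (f l) = ∑ i', HahnSeries.C
              (c i' / c i) * HahnSeries.ofPowerSeries ℤ k (U i' l) := fun l => by
            rw [← ofPowerSeries_X_eq_unif, ← map_mul, ← hf, map_sum]
            simp
          rw [zpow_add₀ unif_ne_zero, zpow_one, mul_smul, Finset.smul_sum]
          simp only [← mul_smul (unif k), hfX, Finset.sum_smul]
          rw [hb₀, Finset.sum_comm, Finset.smul_sum]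
          refine Finset.sum_congr rfl fun l _ => ?_
          rw [hU l, ← mul_smul, mul_assoc, ← zpow_add₀ unif_ne_zero, sub_add_cancel, mul_comm,
            mul_smul, Finset.smul_sum]
          simp only [← mul_smul]
        · rw [Function.update_of_ne h0, Function.update_of_ne h0, hU]
          simp only [Matrix.updateRow_ne h0]
      · intro h
        apply hdet
        have h1 := Matrix.det_updateRow_sum U i₀ fun i => PowerSeries.C (c i / c i₀)
        have h2 : (∑ i, PowerSeries.C (c i / c i₀) • U i) =
            (PowerSeries.X : PowerSeries k) • f := by
          ext1 j
          simpa using hf j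
        rw [h2, Matrix.det_updateRow_smul, div_self hi₀, map_one, one_smul] at h1
        rw [← h1, pow_succ']
        exact mul_dvd_mul_left _ h

theorem exists_isAdapted [Module.Finite (LaurentSeries k) V] {L : Submodule (polyRing k) V}
    {M : Submodule (intRing k) V} (hL : IsLattice L) (hM : IsLattice M) :
    ∃ (v : Fin (Module.finrank (LaurentSeries k) V) → V)
      (n : Fin (Module.finrank (LaurentSeries k) V) → ℤ), IsAdapted L M v n := by
  obtain ⟨b, rfl⟩ := hL
  obtain ⟨e, rfl⟩ := hM
  obtain ⟨N, hN⟩ := exists_unif_pow_mul_mem_intRing_of_finite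
    fun p : Fin (Module.finrank (LaurentSeries k) V) × Fin (Module.finrank (LaurentSeries k) V) =>
      e.repr (b p.1) p.2
  choose U hU using fun i j => hN (i, j)
  have hUe : ∀ i, b i = unif k ^ (-(N : ℤ)) • ∑ j, HahnSeries.ofPowerSeries ℤ k (U i j) • e j := by
    intro i
    simp only [hU, mul_smul, ← Finset.smul_sum]
    rw [e.sum_repr, ← mul_smul, zpow_neg, zpow_natCast,
      inv_mul_cancel₀ (pow_ne_zero _ unif_ne_zero), one_smul]
  have hdet : (Matrix.of U).det ≠ 0 := by
    intro h0
    obtain ⟨c, hc, hc0⟩ := Matrix.exists_vecMul_eq_zero_iff.2 h0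
    apply hc
    ext1 j
    have h1 : ∑ i, HahnSeries.ofPowerSeries ℤ k (c i) • b i = 0 := by
      simp only [hUe, smul_comm _ (unif k ^ (-(N : ℤ))), ← Finset.smul_sum]
      simp only [Finset.smul_sum (r := HahnSeries.ofPowerSeries ℤ k _), ← mul_smul, ← map_mul]
      rw [Finset.sum_comm]
      simp only [← Finset.sum_smul, ← map_sum]
      have h2 : ∀ l, ∑ i, c i * U i l = 0 := fun l => congrFun hc0 l
      simp [h2]
    have h3 := Fintype.linearIndependent_iff.1 b.linearIndependent _ h1 j
    exact HahnSeries.ofPowerSeries_injective (by rw [h3]; simp)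
  refine exists_isAdapted_of_matrix e _ ((Matrix.of U).det.order.toNat + 1) b _ (Matrix.of U) rfl
    hUe fun h => ?_
  have h1 := PowerSeries.X_pow_dvd_iff.1 h (Matrix.of U).det.order.toNat (Nat.lt_succ_self _)
  exact PowerSeries.coeff_order hdet h1

end AdaptedBases

/-! ### Bases of sheaves of modules -/

section FreeSheaves

universe u₁ v₁

variable {C : Type u₁} [Category.{v₁} C] {J : GrothendieckTopology C} {R : Sheaf J RingCat.{u}}

theorem isIso_iff_bijective_app {M N : SheafOfModules.{u} R} (φ : M ⟶ N) :
    IsIso φ ↔ ∀ X, Function.Bijective (φ.val.app X).hom := by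
  rw [← isIso_iff_of_reflects_iso φ (SheafOfModules.forget R),
    ← isIso_iff_of_reflects_iso _ (PresheafOfModules.toPresheaf R.obj),
    NatTrans.isIso_iff_isIso_app]
  refine forall_congr' fun X => ?_
  rw [ConcreteCategory.isIso_iff_bijective]
  rfl

theorem sum_val_app {M N : SheafOfModules.{u} R} {I : Type*} (t : Finset I) (f : I → (M ⟶ N))
    (X : Cᵒᵖ) (x : M.val.obj X) :
    ((∑ i ∈ t, f i).val.app X).hom x = ∑ i ∈ t, ((f i).val.app X).hom x := by
  classical
  induction t using Finset.induction_on with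
  | empty => rfl
  | insert a t ha ih =>
    rw [Finset.sum_insert ha, Finset.sum_insert ha, ← ih]
    rfl

variable [HasWeakSheafify J AddCommGrpCat.{u}] [J.WEqualsLocallyBijective AddCommGrpCat.{u}]

/-- The standard sections form a basis of a free sheaf over every object. The free sheaf is a
coproduct, of which the universal property gives coordinate projections `p i`. -/
theorem bijective_free {I : Type u} [Fintype I] (X : Cᵒᵖ) :
    Function.Bijective fun c : I → R.obj.obj X => ∑ i,
      ((SheafOfModules.ιFree (R := R) i).val.app X).hom (c i) := by
  classical
  let p : ∀ i : I, SheafOfModules.free (R := R) I ⟶ SheafOfModules.unit R := fun i =>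
    Cofan.IsColimit.desc (SheafOfModules.isColimitFreeCofan I) fun j => if j = i then 𝟙 _ else 0
  have hp : ∀ i j, SheafOfModules.ιFree j ≫ p i = if j = i then 𝟙 _ else 0 := fun i j =>
    Cofan.IsColimit.fac (SheafOfModules.isColimitFreeCofan I) _ j
  have hsum : ∑ i, p i ≫ SheafOfModules.ιFree i = 𝟙 _ := by
    refine Cofan.IsColimit.hom_ext (SheafOfModules.isColimitFreeCofan I) _ _ fun j => ?_
    change SheafOfModules.ιFree j ≫ _ = SheafOfModules.ιFree j ≫ _
    rw [Preadditive.comp_sum, Category.comp_id]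
    simp only [← Category.assoc, hp]
    rw [Finset.sum_eq_single j]
    · rw [if_pos rfl, Category.id_comp]
    · intro i _ hij
      rw [if_neg (Ne.symm hij), zero_comp]
    · simp
  have hpι : ∀ (i j) (c : R.obj.obj X), ((p i).val.app X).hom
      (((SheafOfModules.ιFree (R := R) j).val.app X).hom c) = if j = i then c else 0 := by
    intro i j c
    have h := congrArg (fun φ => (φ.val.app X).hom c) (hp i j)
    refine h.trans ?_
    split_ifs <;> rfl
  refine Function.bijective_iff_has_inverse.2 ⟨fun x i => ((p i).val.app X).hom x, ?_, ?_⟩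
  · intro c
    ext i
    dsimp only
    rw [map_sum]
    simp only [hpι]
    exact (Finset.sum_ite_eq' Finset.univ i c).trans (if_pos (Finset.mem_univ i))
  · intro x
    have h := congrArg (fun φ => (φ.val.app X).hom x) hsum
    exact (sum_val_app Finset.univ _ X x).symm.trans h

theorem freeHomEquiv_symm_app_ιFree {M : SheafOfModules.{u} R} {I : Type u} (s : I → M.sections)
    (X : Cᵒᵖ) (i : I) (c : R.obj.obj X) :
    ((M.freeHomEquiv.symm s).val.app X).hom
      (((SheafOfModules.ιFree (R := R) i).val.app X).hom c) = c • (s i).eval X := by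
  have h1 : SheafOfModules.ιFree i ≫ M.freeHomEquiv.symm s = M.unitHomEquiv.symm (s i) := by
    rw [← SheafOfModules.unitHomEquiv_symm_freeHomEquiv_apply, Equiv.apply_symm_apply]
  have h2 : (((SheafOfModules.ιFree i ≫ M.freeHomEquiv.symm s).val.app X).hom
      (1 : R.obj.obj X)) = (s i).eval X := by
    rw [h1]
    have := M.unitHomEquiv_apply_coe (M.unitHomEquiv.symm (s i)) X
    rw [Equiv.apply_symm_apply] at this
    exact this.symm
  have h3 := ((SheafOfModules.ιFree i ≫ M.freeHomEquiv.symm s).val.app X).hom.map_smul c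
    (1 : R.obj.obj X)
  rw [h2] at h3
  rw [← h3]
  have h4 : c • (1 : R.obj.obj X) = c := mul_one c
  exact congrArg (fun z => ((M.freeHomEquiv.symm s).val.app X).hom
    (((SheafOfModules.ιFree (R := R) i).val.app X).hom z)) h4.symm

theorem isIso_freeHomEquiv_symm_iff {M : SheafOfModules.{u} R} {I : Type u} [Fintype I]
    (s : I → M.sections) : IsIso (M.freeHomEquiv.symm s) ↔
      ∀ X, Function.Bijective fun c : I → R.obj.obj X => ∑ i, c i • (s i).eval X := by
  rw [isIso_iff_bijective_app]
  refine forall_congr' fun X => ?_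
  rw [← (bijective_free X).of_comp_iff]
  have : (fun c : I → R.obj.obj X => ∑ i, c i • (s i).eval X) =
      (M.freeHomEquiv.symm s).val.app X ∘ fun c : I → R.obj.obj X => ∑ i,
      ((SheafOfModules.ιFree (R := R) i).val.app X).hom (c i) := by
    ext c
    simp only [Function.comp]
    refine Eq.trans ?_ (map_sum ((M.freeHomEquiv.symm s).val.app X).hom _ _).symm
    exact Finset.sum_congr rfl fun i _ => (freeHomEquiv_symm_app_ιFree s X i (c i)).symm
  rw [this]

end FreeSheaves

section Schemes

variable {X : Scheme.{u}}

/-- The restriction of a section of a sheaf of modules to a smaller open set. -/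
def res (E : X.Modules) {U W : X.Opens} (h : W ≤ U) : Γ(E, U) →+ Γ(E, W) :=
  (E.presheaf.map (homOfLE h).op).hom

/-- The sections `e i` of `E` over `U` are a basis of `E|_U`: over each open subset of `U`, every
section is a unique linear combination of the restrictions of the `e i`. -/
def IsLocalBasis {E : X.Modules} {U : X.Opens} {ι : Type*} [Fintype ι] (e : ι → Γ(E, U)) : Prop :=
  ∀ (W : X.Opens) (h : W ≤ U), Function.Bijective fun c : ι → Γ(X, W) => ∑ i, c i • res E h (e i)

/-- The section of the restricted sheaf `E.over U` given by a section of `E` over `U`. -/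
def overSection (E : X.Modules) {U : X.Opens} (s : Γ(E, U)) :
    (SheafOfModules.over (R := X.ringCatSheaf) E U).sections :=
  PresheafOfModules.sectionsMk
    (M := (SheafOfModules.over (R := X.ringCatSheaf) E U).val)
    (fun W => (E.presheaf.map W.unop.hom.op).hom s) (by
      intro W W' f
      change (E.presheaf.map f.unop.left.op).hom ((E.presheaf.map W.unop.hom.op).hom s) = _
      rw [← CategoryTheory.comp_apply, ← Functor.map_comp]
      rfl)

theorem res_overSection (E : X.Modules) {U W : X.Opens} (h : W ≤ U)
    (t : (SheafOfModules.over (R := X.ringCatSheaf) E U).sections) :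
    t.eval (op (Over.mk (homOfLE h))) = res E h (t.eval (op (Over.mk (𝟙 U)))) :=
  (PresheafOfModules.sections_property t
    (Over.homMk (homOfLE h) : Over.mk (homOfLE h) ⟶ Over.mk (𝟙 U)).op).symm

theorem exists_isLocalBasis_of_sections (E : X.Modules) {U : X.Opens} {I : Type u} [Fintype I]
    (s : I → (SheafOfModules.over (R := X.ringCatSheaf) E U).sections)
    (hs : IsIso ((SheafOfModules.freeHomEquiv _).symm s)) :
    IsLocalBasis fun i => ((s i).eval (op (Over.mk (𝟙 U))) : Γ(E, U)) := by
  intro W h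
  have := (isIso_freeHomEquiv_symm_iff s).1 hs (op (Over.mk (homOfLE h)))
  exact (congrArg Function.Bijective (funext fun c => Finset.sum_congr rfl fun i _ =>
    congrArg (fun z : Γ(E, W) => c i • z) (res_overSection E h (s i)))).mp this

theorem IsLocalBasis.isIso {E : X.Modules} {U : X.Opens} {I : Type u} [Fintype I]
    {e : I → Γ(E, U)} (he : IsLocalBasis e) :
    IsIso ((SheafOfModules.freeHomEquiv _).symm fun i => overSection E (e i)) :=
  (isIso_freeHomEquiv_symm_iff _).2 fun W => he W.unop.left W.unop.hom.le

theorem IsLocalBasis.reindex {E : X.Modules} {U : X.Opens} {I I' : Type*} [Fintype I] [Fintype I']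
    {e : I → Γ(E, U)} (he : IsLocalBasis e) (σ : I' ≃ I) : IsLocalBasis fun i => e (σ i) := by
  intro W h
  have h1 := (he W h).comp (σ.symm.arrowCongr (Equiv.refl Γ(X, W))).symm.bijective
  convert! h1 using 1
  ext c
  refine (Equiv.sum_comp σ.symm _).symm.trans ?_
  simp

end Schemes

/-- A vector bundle has a basis of sections near every point. -/
theorem IsVectorBundle.exists_isLocalBasis {k : Type u} [Field k] {d : ℕ} {E : (P1 k).Modules}
    (hE : IsVectorBundle d E) (x : P1 k) :
    ∃ (U : (P1 k).Opens) (_ : x ∈ U) (e : Fin d → Γ(E, U)), IsLocalBasis e := by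
  obtain ⟨q, hq, hcard⟩ := hE
  obtain ⟨U, f, hU, hx⟩ := q.coversTop ⊤ x trivial
  obtain ⟨i, ⟨g⟩⟩ := (Sieve.mem_ofObjects_iff ..).1 hU
  obtain ⟨hfin, hc⟩ := hcard i
  cases nonempty_fintype (q.generators i).I
  have hb := exists_isLocalBasis_of_sections E (q.generators i).s (hq.isIso i)
  exact ⟨q.X i, g.le hx, _, hb.reindex (Finite.equivFinOfCardEq hc).symm⟩

/-- A local basis as a family of generators of the restricted sheaf. -/
def IsLocalBasis.generators {X : Scheme.{u}} {E : X.Modules} {U : X.Opens} {d : ℕ}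
    {e : Fin d → Γ(E, U)} (he : IsLocalBasis e) :
    (SheafOfModules.over (R := X.ringCatSheaf) E U).GeneratingSections where
  I := ULift.{u} (Fin d)
  s i := overSection E (e i.down)
  epi := by
    have := (he.reindex Equiv.ulift.{u}).isIso
    exact @IsIso.epi_of_iso _ _ _ _ _ this

theorem IsLocalBasis.isIso_generators {X : Scheme.{u}} {E : X.Modules} {U : X.Opens} {d : ℕ}
    {e : Fin d → Γ(E, U)} (he : IsLocalBasis e) : IsIso he.generators.π :=
  (he.reindex Equiv.ulift.{u}).isIso

theorem coversTop_of_mem {X : Scheme.{u}} (U : X → X.Opens) (hU : ∀ x, x ∈ U x) :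
    (Opens.grothendieckTopology X).CoversTop U := by
  intro W x hx
  exact ⟨W ⊓ U x, homOfLE inf_le_left, (Sieve.mem_ofObjects_iff ..).2
    ⟨x, ⟨homOfLE inf_le_right⟩⟩, hx, hU x⟩

/-- A covering by open sets on which `E` has bases, as local generators. -/
def localGeneratorsData {X : Scheme.{u}} {E : X.Modules} {d : ℕ} (U : X → X.Opens)
    (hU : ∀ x, x ∈ U x) {e : ∀ x, Fin d → Γ(E, U x)} (he : ∀ x, IsLocalBasis (e x)) :
    SheafOfModules.LocalGeneratorsData.{u} (R := X.ringCatSheaf) E where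
  I := X
  X := U
  coversTop := coversTop_of_mem U hU
  generators x := (he x).generators

theorem isLocallyFreeData_localGeneratorsData {X : Scheme.{u}} {E : X.Modules} {d : ℕ}
    (U : X → X.Opens) (hU : ∀ x, x ∈ U x) {e : ∀ x, Fin d → Γ(E, U x)}
    (he : ∀ x, IsLocalBasis (e x)) : (localGeneratorsData U hU he).IsLocallyFreeData where
  isIso x := (he x).isIso_generators

theorem isVectorBundle_of_isLocalBasis {k : Type u} [Field k] {d : ℕ} {E : (P1 k).Modules}
    (hE : ∀ x, ∃ (U : (P1 k).Opens) (_ : x ∈ U) (e : Fin d → Γ(E, U)), IsLocalBasis e) :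
    IsVectorBundle d E := by
  choose U hU e he using hE
  refine ⟨localGeneratorsData U hU he, isLocallyFreeData_localGeneratorsData U hU he, fun x => ?_⟩
  have h1 : ((localGeneratorsData U hU he).generators x).I = ULift.{u} (Fin d) := rfl
  rw [h1]
  exact ⟨inferInstance, by simp⟩

/-! ### Rational functions on the projective line -/

section Forms

variable {k : Type u} [Field k]

/-- Evaluation of a form at `X₀ = π`, `X₁ = 1`: in terms of the local coordinate `π` at infinity. -/
def evalInfty (k : Type u) [Field k] : Coord k →+* PowerSeries k :=
  MvPolynomial.eval₂Hom PowerSeries.C ![PowerSeries.X, 1]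

theorem degree_eq_of_mem_grading {m : ℕ} {s : Coord k} (hs : s ∈ grading k m) {d : Fin 2 →₀ ℕ}
    (hd : s.coeff d ≠ 0) : d 0 + d 1 = m := by
  have h1 : MvPolynomial.IsHomogeneous s m := hs
  simpa [Finsupp.weight_apply, Finsupp.sum_fintype, Fin.sum_univ_two] using h1 hd

theorem evalForm_mem_polyRing (s : Coord k) : evalForm k s ∈ polyRing k := by
  induction s using MvPolynomial.induction_on with
  | C a => simpa [evalForm] using C_mem_polyRing a
  | add p q hp hq => rw [map_add]; exact add_mem hp hq
  | mul_X p i hp =>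
    rw [map_mul]
    refine mul_mem hp ?_
    fin_cases i
    · simp [evalForm]
    · simpa [evalForm] using varT_mem_polyRing

@[simp] theorem evalForm_X_zero : evalForm k (MvPolynomial.X 0) = 1 := by simp [evalForm]

@[simp] theorem evalForm_X_one : evalForm k (MvPolynomial.X 1) = varT k := by simp [evalForm]

@[simp] theorem evalForm_C (a : k) : evalForm k (MvPolynomial.C a) = HahnSeries.C a := by
  simp [evalForm]

/-- A form of degree `m` satisfies `s(1, T) = T ^ m * s(π, 1)`. -/
theorem evalForm_eq {m : ℕ} {s : Coord k} (hs : s ∈ grading k m) :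
    evalForm k s = varT k ^ m * HahnSeries.ofPowerSeries ℤ k (evalInfty k s) := by
  rw [evalForm, evalInfty, MvPolynomial.coe_eval₂Hom, MvPolynomial.coe_eval₂Hom,
    MvPolynomial.eval₂_eq', MvPolynomial.eval₂_eq', map_sum, Finset.mul_sum]
  refine Finset.sum_congr rfl fun d hd => ?_
  have h := degree_eq_of_mem_grading hs (MvPolynomial.mem_support_iff.1 hd)
  simp only [Fin.prod_univ_two, Matrix.cons_val_zero, Matrix.cons_val_one, one_pow, mul_one,
    one_mul, map_mul, map_pow, ofPowerSeries_X_eq_unif, HahnSeries.ofPowerSeries_C]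
  rw [← h, pow_add, varT]
  have hu : (unif k)⁻¹ ^ d 0 * unif k ^ d 0 = 1 := by
    rw [← mul_pow, inv_mul_cancel₀ unif_ne_zero, one_pow]
  linear_combination -(HahnSeries.C (s.coeff d) * (unif k)⁻¹ ^ d 1) * hu

/-- A form that vanishes at `∞` is divisible by `X₀`. -/
theorem mem_span_of_constantCoeff_evalInfty {m : ℕ} {s : Coord k} (hs : s ∈ grading k m)
    (h : PowerSeries.constantCoeff (evalInfty k s) = 0) :
    s ∈ Ideal.span {(MvPolynomial.X 0 : Coord k)} := by
  have himg : (MvPolynomial.X '' {(0 : Fin 2)} : Set (Coord k)) = {MvPolynomial.X 0} := by simp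
  rw [← himg, MvPolynomial.mem_ideal_span_X_image]
  intro e he
  refine ⟨0, rfl, fun he0 => MvPolynomial.mem_support_iff.1 he ?_⟩
  rw [← h, evalInfty, MvPolynomial.coe_eval₂Hom, MvPolynomial.eval₂_eq', map_sum,
    Finset.sum_eq_single e]
  · simp [Fin.prod_univ_two, he0]
  · intro d hd hde
    have hd0 : d 0 ≠ 0 := by
      intro hd0
      apply hde
      have ha := degree_eq_of_mem_grading hs (MvPolynomial.mem_support_iff.1 hd)
      have hb := degree_eq_of_mem_grading hs (MvPolynomial.mem_support_iff.1 he)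
      ext i
      fin_cases i
      · simp [hd0, he0]
      · simp only [Fin.mk_one]
        omega
    simp [Fin.prod_univ_two, hd0]
  · intro he'
    simp [MvPolynomial.notMem_support_iff.1 he']

theorem mem_inftyPt {s : Coord k} : s ∈ (inftyPt k).asHomogeneousIdeal ↔
    s ∈ Ideal.span {(MvPolynomial.X 0 : Coord k)} := Iff.rfl

theorem isUnit_evalInfty {m : ℕ} {s : Coord k} (hs : s ∈ grading k m)
    (h : s ∉ (inftyPt k).asHomogeneousIdeal) : IsUnit (evalInfty k s) := by
  rw [PowerSeries.isUnit_iff_constantCoeff, isUnit_iff_ne_zero]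
  exact fun h0 => h (mem_span_of_constantCoeff_evalInfty hs h0)

theorem evalForm_div_evalForm {m : ℕ} {r s : Coord k} (hr : r ∈ grading k m)
    (hs : s ∈ grading k m) : evalForm k r / evalForm k s =
    HahnSeries.ofPowerSeries ℤ k (evalInfty k r) /
      HahnSeries.ofPowerSeries ℤ k (evalInfty k s) := by
  rw [evalForm_eq hr, evalForm_eq hs, mul_div_mul_left _ _ (pow_ne_zero _ varT_ne_zero)]

theorem evalForm_div_mem_intRing {m : ℕ} {r s : Coord k} (hr : r ∈ grading k m)
    (hs : s ∈ grading k m) (h : s ∉ (inftyPt k).asHomogeneousIdeal) :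
    evalForm k r / evalForm k s ∈ intRing k := by
  obtain ⟨w, hw⟩ := isUnit_evalInfty hs h
  rw [evalForm_div_evalForm hr hs, ← hw]
  have : (HahnSeries.ofPowerSeries ℤ k (w : PowerSeries k))⁻¹ =
      HahnSeries.ofPowerSeries ℤ k ((w⁻¹ : (PowerSeries k)ˣ) : PowerSeries k) := by
    apply inv_eq_of_mul_eq_one_right
    rw [← map_mul, Units.mul_inv, map_one]
  rw [div_eq_mul_inv, this, ← map_mul]
  exact ofPowerSeries_mem_intRing _

theorem exists_eq_X_zero_mul {m : ℕ} {s : Coord k} (hs : s ∈ grading k (m + 1))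
    (h : s ∈ Ideal.span {(MvPolynomial.X 0 : Coord k)}) :
    ∃ t ∈ grading k m, s = MvPolynomial.X 0 * t := by
  obtain ⟨t, rfl⟩ := Ideal.mem_span_singleton.1 h
  refine ⟨t, ?_, rfl⟩
  intro d hd
  have h1 : MvPolynomial.IsHomogeneous (MvPolynomial.X 0 * t) (m + 1) := hs
  have h2 := h1 (d := Finsupp.single 0 1 + d) (by rwa [MvPolynomial.coeff_X_mul])
  rw [map_add, Finsupp.weight_single] at h2
  simp at h2
  omega

/-- A quotient of two forms of the same degree that lies in `k[[π]]` is a quotient of two forms such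
that the denominator does not vanish at `∞`: powers of `X₀` can be cancelled. -/
theorem exists_regular_fraction (m : ℕ) : ∀ {r s : Coord k}, r ∈ grading k m → s ∈ grading k m →
    s ≠ 0 → evalForm k r / evalForm k s ∈ intRing k →
    ∃ (j : ℕ) (r' s' : Coord k), r' ∈ grading k j ∧ s' ∈ grading k j ∧
      s' ∉ (inftyPt k).asHomogeneousIdeal ∧
      evalForm k r' / evalForm k s' = evalForm k r / evalForm k s := by
  induction m with
  | zero =>
    intro r s hr hs h0 h
    refine ⟨0, r, s, hr, hs, fun hmem => ?_, rfl⟩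
    rw [mem_inftyPt, Ideal.mem_span_singleton] at hmem
    have hs' : s.totalDegree = 0 :=
      Nat.le_zero.1 (MvPolynomial.IsHomogeneous.totalDegree_le hs)
    rw [MvPolynomial.totalDegree_eq_zero_iff_eq_C] at hs'
    obtain ⟨t, ht⟩ := hmem
    apply h0
    rw [hs']
    have h1 := congrArg MvPolynomial.constantCoeff ht
    rw [map_mul, MvPolynomial.constantCoeff_X, zero_mul, MvPolynomial.constantCoeff_eq] at h1
    rw [h1, map_zero]
  | succ m ih =>
    intro r s hr hs h0 h
    by_cases hmem : s ∈ (inftyPt k).asHomogeneousIdeal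
    · have hs0 := evalForm_ne_zero hs h0
      obtain ⟨g, hg⟩ := h
      have h1 : evalInfty k r = g * evalInfty k s := by
        rw [evalForm_div_evalForm hr hs] at hg
        have h2 : HahnSeries.ofPowerSeries ℤ k (evalInfty k s) ≠ 0 := by
          rw [evalForm_eq hs] at hs0
          exact right_ne_zero_of_mul hs0
        rw [eq_div_iff h2, ← map_mul] at hg
        exact (HahnSeries.ofPowerSeries_injective hg).symm
      have hrmem : r ∈ Ideal.span {(MvPolynomial.X 0 : Coord k)} := by
        apply mem_span_of_constantCoeff_evalInfty hr
        obtain ⟨t, rfl⟩ := Ideal.mem_span_singleton.1 (mem_inftyPt.1 hmem)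
        rw [h1, map_mul, map_mul, map_mul]
        simp [evalInfty]
      obtain ⟨s', hs', rfl⟩ := exists_eq_X_zero_mul hs hmem
      obtain ⟨r', hr', rfl⟩ := exists_eq_X_zero_mul hr hrmem
      have h3 : evalForm k (MvPolynomial.X 0 * r') / evalForm k (MvPolynomial.X 0 * s') =
          evalForm k r' / evalForm k s' := by
        simp
      rw [h3]
      exact ih hr' hs' (right_ne_zero_of_mul h0) (h3 ▸ ⟨g, hg⟩)
    · exact ⟨m + 1, r, s, hr, hs, hmem, rfl⟩

theorem eq_inftyPt_of_notMem_finChart {x : P1 k} (hx : x ∉ finChart k) : x = inftyPt k := by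
  have hX0 : (MvPolynomial.X 0 : Coord k) ∈ x.asHomogeneousIdeal := by
    by_contra h
    exact hx h
  have hX1 : (MvPolynomial.X 1 : Coord k) ∉ x.asHomogeneousIdeal := by
    intro h1
    obtain ⟨s, hs, hsx⟩ := exists_notMem x 1
    apply hsx
    have : s ∈ Ideal.span (MvPolynomial.X '' (Set.univ : Set (Fin 2))) := by
      rw [MvPolynomial.mem_ideal_span_X_image]
      intro e he
      have h2 := degree_eq_of_mem_grading hs (MvPolynomial.mem_support_iff.1 he)
      by_contra! hc
      have := hc 0 trivial
      have := hc 1 trivial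
      omega
    refine (Ideal.span_le (I := x.asHomogeneousIdeal.toIdeal)).2 ?_ this
    rintro _ ⟨i, -, rfl⟩
    fin_cases i
    · exact hX0
    · exact h1
  refine ProjectiveSpectrum.ext (HomogeneousIdeal.toIdeal_injective (le_antisymm ?_ ?_))
  · classical
    intro s hs
    change s ∈ Ideal.span {(MvPolynomial.X 0 : Coord k)}
    rw [← DirectSum.sum_support_decompose (grading k) s]
    refine sum_mem fun m _ => ?_
    have hm : (DirectSum.decompose (grading k) s m : Coord k) ∈ x.asHomogeneousIdeal :=
      x.asHomogeneousIdeal.isHomogeneous m hs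
    have hg := (DirectSum.decompose (grading k) s m).2
    generalize (DirectSum.decompose (grading k) s m : Coord k) = t at hm hg
    -- Modulo `X₀` the form `t` is a multiple `c * X₁ ^ m` of a power of `X₁`.
    set c := PowerSeries.constantCoeff (evalInfty k t) with hc
    have hmon : MvPolynomial.C c * MvPolynomial.X 1 ^ m ∈ grading k m := by
      simpa using (MvPolynomial.isHomogeneous_C (Fin 2) c).mul
        ((MvPolynomial.isHomogeneous_X k (1 : Fin 2)).pow m)
    have hsub : t - MvPolynomial.C c * MvPolynomial.X 1 ^ m ∈
        Ideal.span {(MvPolynomial.X 0 : Coord k)} := by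
      refine mem_span_of_constantCoeff_evalInfty (sub_mem hg hmon) ?_
      rw [map_sub, map_sub, ← hc]
      simp [evalInfty]
    have hspan : Ideal.span {(MvPolynomial.X 0 : Coord k)} ≤ x.asHomogeneousIdeal.toIdeal := by
      rw [Ideal.span_le]
      rintro _ rfl
      exact hX0
    have hcX : MvPolynomial.C c * MvPolynomial.X 1 ^ m ∈ x.asHomogeneousIdeal.toIdeal := by
      simpa using sub_mem (show t ∈ x.asHomogeneousIdeal.toIdeal from hm) (hspan hsub)
    have hc0 : c = 0 := by
      by_contra hc0
      refine hX1 (x.isPrime.mem_of_pow_mem m ((x.isPrime.mem_or_mem hcX).resolve_left fun h => ?_))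
      refine x.isPrime.ne_top (Ideal.eq_top_of_isUnit_mem _ h ?_)
      exact (isUnit_iff_ne_zero.2 hc0).map MvPolynomial.C
    exact mem_span_of_constantCoeff_evalInfty hg hc0
  · change Ideal.span {(MvPolynomial.X 0 : Coord k)} ≤ _
    rw [Ideal.span_le]
    rintro _ rfl
    exact hX0

end Forms

section Functions

variable {k : Type u} [Field k]

/-- The regular function on `U` given by a fraction `r / s` whose denominator has no zero on `U`. -/
def fracSection (U : (P1 k).Opens) {m : ℕ} {r s : Coord k} (hr : r ∈ grading k m)
    (hs : s ∈ grading k m) (hU : ∀ x ∈ U, s ∉ x.asHomogeneousIdeal) : Γ(P1 k, U) :=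
  ⟨fun x => .mk ⟨m, ⟨r, hr⟩, ⟨s, hs⟩, hU x.1 x.2⟩, fun x =>
    ⟨U, x.2, 𝟙 U, m, ⟨r, hr⟩, ⟨s, hs⟩, fun y => hU y.1 y.2, fun _ => rfl⟩⟩

theorem expand_fracSection (U : (P1 k).Opens) {m : ℕ} {r s : Coord k} (hr : r ∈ grading k m)
    (hs : s ∈ grading k m) (hU : ∀ x ∈ U, s ∉ x.asHomogeneousIdeal) (hη : genPt k ∈ U) :
    expand U hη (fracSection U hr hs hU) = evalForm k r / evalForm k s := rfl

theorem expand_map {U W : (P1 k).Opens} (h : W ≤ U) (hW : genPt k ∈ W) (f : Γ(P1 k, U)) :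
    expand W hW ((P1 k).presheaf.map (homOfLE h).op f) = expand U (h hW) f := rfl

/-- Near each point a regular function is a fraction. -/
theorem exists_fraction {U : (P1 k).Opens} (f : Γ(P1 k, U)) (x : P1 k) (hx : x ∈ U) :
    ∃ (W : (P1 k).Opens) (_ : x ∈ W) (h : W ≤ U) (m : ℕ) (r s : Coord k) (hr : r ∈ grading k m)
      (hs : s ∈ grading k m) (hW : ∀ y ∈ W, s ∉ y.asHomogeneousIdeal),
      (P1 k).presheaf.map (homOfLE h).op f = fracSection W hr hs hW := by
  obtain ⟨W, hxW, i, m, ⟨r, hr⟩, ⟨s, hs⟩, hW, h⟩ := f.2 ⟨x, hx⟩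
  exact ⟨W, hxW, i.le, m, r, s, hr, hs, fun y hy => hW ⟨y, hy⟩, Subtype.ext (funext h)⟩

theorem exists_fraction_expand {U : (P1 k).Opens} (hU : genPt k ∈ U) (f : Γ(P1 k, U)) (x : P1 k)
    (hx : x ∈ U) : ∃ (m : ℕ) (r s : Coord k), r ∈ grading k m ∧ s ∈ grading k m ∧
      s ∉ x.asHomogeneousIdeal ∧ s ≠ 0 ∧ expand U hU f = evalForm k r / evalForm k s := by
  obtain ⟨W, hxW, h, m, r, s, hr, hs, hW, hf⟩ := exists_fraction f x hx
  refine ⟨m, r, s, hr, hs, hW x hxW, ?_, ?_⟩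
  · rintro rfl
    exact hW x hxW (zero_mem _)
  · rw [← expand_map h (genPt_mem W x hxW), hf, expand_fracSection]

theorem expand_injective (U : (P1 k).Opens) (hU : genPt k ∈ U) :
    Function.Injective (expand U hU) := by
  rw [injective_iff_map_eq_zero]
  intro f hf
  refine Subtype.ext (funext fun x => ?_)
  obtain ⟨W, hxW, h, m, r, s, hr, hs, hW, hfW⟩ := exists_fraction f x.1 x.2
  have hs0 : s ≠ 0 := by
    rintro rfl
    exact hW x.1 hxW (zero_mem _)
  have hr0 : r = 0 := by
    by_contra hr0
    rw [← expand_map h (genPt_mem W x.1 hxW), hfW, expand_fracSection] at hf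
    exact div_ne_zero (evalForm_ne_zero hr hr0) (evalForm_ne_zero hs hs0) hf
  have h1 := congrFun (congrArg Subtype.val hfW) ⟨x.1, hxW⟩
  refine h1.trans ?_
  subst hr0
  apply HomogeneousLocalization.val_injective
  exact (HomogeneousLocalization.val_mk _).trans
    ((Localization.mk_zero _).trans HomogeneousLocalization.val_zero.symm)

theorem expand_mem_intRing {U : (P1 k).Opens} (hU : genPt k ∈ U) (h : inftyPt k ∈ U)
    (f : Γ(P1 k, U)) : expand U hU f ∈ intRing k := by
  obtain ⟨m, r, s, hr, hs, hs', -, hf⟩ := exists_fraction_expand hU f _ h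
  exact hf ▸ evalForm_div_mem_intRing hr hs hs'

theorem exists_mul_expand_mem_polyRing {U : (P1 k).Opens} (hU : genPt k ∈ U) (f : Γ(P1 k, U)) :
    ∃ p ∈ polyRing k, p ≠ 0 ∧ p * expand U hU f ∈ polyRing k := by
  obtain ⟨m, r, s, hr, hs, -, hs0, hf⟩ := exists_fraction_expand hU f _ hU
  refine ⟨_, evalForm_mem_polyRing s, evalForm_ne_zero hs hs0, ?_⟩
  rw [hf, mul_div_cancel₀ _ (evalForm_ne_zero hs hs0)]
  exact evalForm_mem_polyRing r

/-- A rational function with expansion in `k[[π]]` is regular near `∞`. -/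
theorem exists_expand_eq {U U' : (P1 k).Opens} (hU : genPt k ∈ U) (f : Γ(P1 k, U))
    (h : expand U hU f ∈ intRing k) (hU' : inftyPt k ∈ U') :
    ∃ (W : (P1 k).Opens) (_ : inftyPt k ∈ W) (_ : W ≤ U') (g : Γ(P1 k, W)),
      ∀ hW, expand W hW g = expand U hU f := by
  obtain ⟨m, r, s, hr, hs, -, hs0, hf⟩ := exists_fraction_expand hU f _ hU
  obtain ⟨j, r', s', hr', hs', hs'', he⟩ := exists_regular_fraction m hr hs hs0 (hf ▸ h)
  refine ⟨U' ⊓ Proj.basicOpen (grading k) s', ⟨hU', hs''⟩, inf_le_left,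
    fracSection _ hr' hs' fun x hx => hx.2, fun hW => ?_⟩
  rw [hf, ← he]
  rfl

theorem isAffineOpen_finChart : IsAffineOpen (finChart k) :=
  Proj.isAffineOpen_basicOpen (grading k) _ (MvPolynomial.isHomogeneous_X k 0) one_pos

theorem range_expand_finChart :
    (expand (finChart k) genPt_mem_finChart).range = polyRing k := by
  apply le_antisymm
  · rintro _ ⟨f, rfl⟩
    obtain ⟨a, rfl⟩ := (ConcreteCategory.bijective_of_isIso
      (Proj.basicOpenIsoAway (grading k) (MvPolynomial.X 0)
        (MvPolynomial.isHomogeneous_X k 0) one_pos).hom).2 f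
    obtain ⟨n, r, hr, rfl⟩ := HomogeneousLocalization.Away.mk_surjective (grading k)
      (MvPolynomial.isHomogeneous_X k 0) a
    change evalForm k r / evalForm k (MvPolynomial.X 0 ^ n) ∈ polyRing k
    rw [map_pow, evalForm_X_zero, one_pow, div_one]
    exact evalForm_mem_polyRing r
  · rintro _ ⟨p, rfl⟩
    induction p using Polynomial.induction_on' with
    | add p q hp hq => rw [map_add]; exact add_mem hp hq
    | monomial n a =>
      have hX0 : ∀ x ∈ finChart k, (MvPolynomial.X 0 : Coord k) ∉ x.asHomogeneousIdeal :=
        fun x hx => hx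
      have hX0' : ∀ x ∈ finChart k, (1 : Coord k) ∉ x.asHomogeneousIdeal :=
        fun x _ h => x.isPrime.ne_top ((Ideal.eq_top_iff_one _).2 h)
      have hT : varT k ∈ (expand (finChart k) genPt_mem_finChart).range :=
        ⟨fracSection _ (MvPolynomial.isHomogeneous_X k 1) (MvPolynomial.isHomogeneous_X k 0) hX0, by
          refine (expand_fracSection _ _ _ hX0 genPt_mem_finChart).trans ?_
          simp⟩
      have hC : HahnSeries.C a ∈ (expand (finChart k) genPt_mem_finChart).range :=
        ⟨fracSection _ (MvPolynomial.isHomogeneous_C (Fin 2) a) (MvPolynomial.isHomogeneous_one ..)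
          hX0', by
          refine (expand_fracSection _ _ _ hX0' genPt_mem_finChart).trans ?_
          simp⟩
      simpa using mul_mem hC (pow_mem hT n)

end Functions

/-! ### Sections of sheaves of modules, and coordinates in a local basis -/

section Sections

variable {X : Scheme.{u}} {E : X.Modules} {U W W' : X.Opens}

/-- Restriction of functions. -/
abbrev resFun (h : W ≤ U) : Γ(X, U) →+* Γ(X, W) := (X.presheaf.map (homOfLE h).op).hom

@[simp] theorem res_res (h : W ≤ U) (h' : W' ≤ W) (s : Γ(E, U)) :
    res E h' (res E h s) = res E (h'.trans h) s := by
  change (E.presheaf.map _).hom ((E.presheaf.map _).hom s) = (E.presheaf.map _).hom s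
  rw [← CategoryTheory.comp_apply, ← Functor.map_comp]
  rfl

@[simp] theorem res_self (h : U ≤ U) (s : Γ(E, U)) : res E h s = s := by
  change (E.presheaf.map (𝟙 (op U))).hom s = s
  rw [E.presheaf.map_id]
  rfl

theorem res_smul (h : W ≤ U) (f : Γ(X, U)) (s : Γ(E, U)) :
    res E h (f • s) = resFun h f • res E h s :=
  E.map_smul (homOfLE h) f s

theorem germ_res_eq (h : W ≤ U) (x : X) (hx : x ∈ W) (s : Γ(E, U)) :
    E.presheaf.germ W x hx (res E h s) = E.presheaf.germ U x (h hx) s :=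
  E.presheaf.germ_res_apply (homOfLE h) x hx s

theorem exists_res_eq_of_germ_eq {x : X} (hx : x ∈ U) (hx' : x ∈ W) {s : Γ(E, U)} {t : Γ(E, W)}
    (h : E.presheaf.germ U x hx s = E.presheaf.germ W x hx' t) :
    ∃ (O : X.Opens) (_ : x ∈ O) (hU : O ≤ U) (hW : O ≤ W), res E hU s = res E hW t := by
  obtain ⟨O, hO, i, j, h⟩ := E.presheaf.germ_eq x hx hx' s t h
  exact ⟨O, hO, i.le, j.le, h⟩

theorem eq_of_locally_res_eq {s t : Γ(E, U)}
    (h : ∀ x ∈ U, ∃ (W : X.Opens) (_ : x ∈ W) (hW : W ≤ U), res E hW s = res E hW t) : s = t := by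
  choose W hxW hW hst using h
  exact TopCat.Sheaf.eq_of_locally_eq' ⟨E.presheaf, E.isSheaf⟩
    (fun x : U => W x.1 x.2) U (fun x => homOfLE (hW x.1 x.2))
    (fun x hx => Opens.mem_iSup.2 ⟨⟨x, hx⟩, hxW x hx⟩) s t fun x => hst x.1 x.2

theorem exists_gluing (W : U → X.Opens) (hxW : ∀ x, x.1 ∈ W x) (hW : ∀ x, W x ≤ U)
    (s : ∀ x, Γ(E, W x)) (hs : ∀ x y, res E (inf_le_left : W x ⊓ W y ≤ W x) (s x) =
      res E (inf_le_right : W x ⊓ W y ≤ W y) (s y)) :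
    ∃ t : Γ(E, U), ∀ x, res E (hW x) t = s x := by
  obtain ⟨t, ht, -⟩ := TopCat.Sheaf.existsUnique_gluing' ⟨E.presheaf, E.isSheaf⟩
    W U (fun x => homOfLE (hW x)) (fun x hx => Opens.mem_iSup.2 ⟨⟨x, hx⟩, hxW ⟨x, hx⟩⟩) s
    fun x y => hs x y
  exact ⟨t, ht⟩

variable {ι : Type*} [Fintype ι] {e : ι → Γ(E, U)}

theorem IsLocalBasis.restrict (he : IsLocalBasis e) (h : W ≤ U) :
    IsLocalBasis fun i => res E h (e i) := by
  intro O hO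
  simpa only [res_res] using he O (hO.trans h)

/-- The coordinates of a section in a local basis. -/
def IsLocalBasis.coord (he : IsLocalBasis e) (h : W ≤ U) (s : Γ(E, W)) : ι → Γ(X, W) :=
  ((he W h).2 s).choose

theorem IsLocalBasis.sum_coord (he : IsLocalBasis e) (h : W ≤ U) (s : Γ(E, W)) :
    ∑ i, he.coord h s i • res E h (e i) = s :=
  ((he W h).2 s).choose_spec

theorem IsLocalBasis.coord_eq (he : IsLocalBasis e) (h : W ≤ U) {s : Γ(E, W)} {c : ι → Γ(X, W)}
    (hc : ∑ i, c i • res E h (e i) = s) : he.coord h s = c :=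
  (he W h).1 ((he.sum_coord h s).trans hc.symm)

theorem IsLocalBasis.coord_res (he : IsLocalBasis e) (h : W ≤ U) (h' : W' ≤ W) (s : Γ(E, W)) (i) :
    he.coord (h'.trans h) (res E h' s) i = resFun h' (he.coord h s i) := by
  refine congrFun (he.coord_eq (c := fun i => resFun h' (he.coord h s i)) _ ?_) i
  conv_rhs => rw [← he.sum_coord h s, map_sum]
  simp only [res_smul, res_res]

theorem IsLocalBasis.coord_add (he : IsLocalBasis e) (h : W ≤ U) (s t : Γ(E, W)) :
    he.coord h (s + t) = he.coord h s + he.coord h t := by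
  refine he.coord_eq h ?_
  simp only [Pi.add_apply, add_smul, Finset.sum_add_distrib, he.sum_coord]

theorem IsLocalBasis.coord_smul (he : IsLocalBasis e) (h : W ≤ U) (f : Γ(X, W)) (s : Γ(E, W)) :
    he.coord h (f • s) = f • he.coord h s := by
  refine he.coord_eq h ?_
  simp only [Pi.smul_apply, smul_assoc, ← Finset.smul_sum, he.sum_coord]

theorem IsLocalBasis.coord_self [DecidableEq ι] (he : IsLocalBasis e) (i : ι) :
    he.coord le_rfl (e i) = Pi.single i 1 := by
  refine he.coord_eq le_rfl ?_
  rw [Finset.sum_eq_single i]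
  · simp
  · intro j _ hj
    simp [Pi.single_eq_of_ne hj]
  · simp

end Sections

section GenericFibre

variable {k : Type u} [Field k] {E : (P1 k).Modules} {U W : (P1 k).Opens} {d : ℕ}

/-- Sections of a vector bundle are determined by their germs at the generic point. -/
theorem germ_genPt_injective (hE : IsVectorBundle d E) (hU : genPt k ∈ U) :
    Function.Injective (E.presheaf.germ U (genPt k) hU) := by
  intro s t hst
  obtain ⟨O, hO, hOU, _, hres⟩ := exists_res_eq_of_germ_eq hU hU hst
  refine eq_of_locally_res_eq fun x hx => ?_
  obtain ⟨N, hxN, e, he⟩ := hE.exists_isLocalBasis x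
  have hη : genPt k ∈ N := genPt_mem N x hxN
  refine ⟨U ⊓ N, ⟨hx, hxN⟩, inf_le_left, ?_⟩
  rw [← he.sum_coord inf_le_right (res E inf_le_left s),
    ← he.sum_coord inf_le_right (res E inf_le_left t)]
  have hle : O ⊓ N ≤ U ⊓ N := inf_le_inf_right _ hOU
  have hc : he.coord inf_le_right (res E (inf_le_left : U ⊓ N ≤ U) s) =
      he.coord inf_le_right (res E (inf_le_left : U ⊓ N ≤ U) t) := by
    funext i
    have hUN : genPt k ∈ U ⊓ N := ⟨hU, hη⟩
    have hON : genPt k ∈ O ⊓ N := ⟨hO, hη⟩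
    apply expand_injective (U ⊓ N) hUN
    rw [← expand_map hle hON, ← expand_map hle hON]
    have h1 : res E hle (res E inf_le_left s) = res E hle (res E inf_le_left t) := by
      have h0 := congrArg (res E (inf_le_left : O ⊓ N ≤ O)) hres
      rw [res_res, res_res] at h0
      rw [res_res, res_res]
      exact h0
    have h2 := he.coord_res inf_le_right hle (res E inf_le_left s) i
    have h3 := he.coord_res inf_le_right hle (res E inf_le_left t) i
    rw [h1] at h2
    exact congrArg _ (h2.symm.trans h3)
  rw [hc]

variable {V : Type v} [AddCommGroup V]

/-- The vector of `V` given by a section and a map from the generic stalk to `V`. -/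
def genVal (θ : E.presheaf.stalk (genPt k) →+ V) (hU : genPt k ∈ U) : Γ(E, U) →+ V :=
  θ.comp (E.presheaf.germ U (genPt k) hU).hom

variable {θ : E.presheaf.stalk (genPt k) →+ V}

theorem genVal_res (h : W ≤ U) (hW : genPt k ∈ W) (s : Γ(E, U)) :
    genVal θ hW (res E h s) = genVal θ (h hW) s :=
  congrArg θ (germ_res_eq h _ hW s)

theorem genVal_injective (hE : IsVectorBundle d E) (hinj : Function.Injective θ)
    (hU : genPt k ∈ U) : Function.Injective (genVal θ hU) :=
  hinj.comp (germ_genPt_injective hE hU)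

/-- A vector that is locally the value of a section is the value of a section. -/
theorem exists_genVal_eq_of_locally (hE : IsVectorBundle d E) (hinj : Function.Injective θ)
    (hU : genPt k ∈ U) (w : V) (h : ∀ x ∈ U, ∃ (W : (P1 k).Opens) (hx : x ∈ W) (_ : W ≤ U)
      (s : Γ(E, W)), genVal θ (genPt_mem W x hx) s = w) : ∃ s : Γ(E, U), genVal θ hU s = w := by
  choose W hxW hW s hs using h
  obtain ⟨t, ht⟩ := exists_gluing (fun x : U => W x.1 x.2) (fun x => hxW x.1 x.2)
    (fun x => hW x.1 x.2) (fun x => s x.1 x.2) (fun x y => by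
      have hη : genPt k ∈ W x.1 x.2 ⊓ W y.1 y.2 :=
        ⟨genPt_mem _ _ (hxW x.1 x.2), genPt_mem _ _ (hxW y.1 y.2)⟩
      apply genVal_injective hE hinj hη
      rw [genVal_res, genVal_res, hs, hs])
  refine ⟨t, ?_⟩
  have h1 := ht ⟨genPt k, hU⟩
  rw [← genVal_res (hW _ hU) (genPt_mem _ _ (hxW _ hU)) t, h1, hs]

variable [Module (LaurentSeries k) V]

/-- Additive maps from the generic stalk to a `K_∞`-vector space that are linear over `k(T)`. -/
def IsSemilinear (θ : E.presheaf.stalk (genPt k) →+ V) : Prop :=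
  ∀ (U : (P1 k).Opens) (hU : genPt k ∈ U) (f : Γ(P1 k, U)) (s : Γ(E, U)),
    θ (E.presheaf.germ U _ hU (f • s)) = expand U hU f • θ (E.presheaf.germ U _ hU s)

theorem IsSemilinear.genVal_smul (hθ : IsSemilinear θ) (hU : genPt k ∈ U) (f : Γ(P1 k, U))
    (s : Γ(E, U)) : genVal θ hU (f • s) = expand U hU f • genVal θ hU s := hθ U hU f s

theorem IsSemilinear.genVal_eq_sum (hθ : IsSemilinear θ) {ι : Type*} [Fintype ι]
    {e : ι → Γ(E, U)} (he : IsLocalBasis e) (h : W ≤ U) (hW : genPt k ∈ W) (s : Γ(E, W)) :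
    genVal θ hW s = ∑ i, expand W hW (he.coord h s i) • genVal θ (h hW) (e i) := by
  conv_lhs => rw [← he.sum_coord h s, map_sum]
  simp only [hθ.genVal_smul, genVal_res]

theorem span_stalk_inftyPt (hθ : IsSemilinear θ) {ι : Type*} [Fintype ι] {e : ι → Γ(E, U)}
    (he : IsLocalBasis e) (hU : inftyPt k ∈ U) :
    Submodule.span (intRing k) (Set.range fun t : E.presheaf.stalk (inftyPt k) =>
      θ (E.presheaf.stalkSpecializes (genPt_specializes (inftyPt k)) t)) =
    Submodule.span (intRing k) (Set.range fun i => genVal θ (genPt_mem U _ hU) (e i)) := by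
  apply le_antisymm
  · rw [Submodule.span_le]
    rintro _ ⟨t, rfl⟩
    obtain ⟨W, hW, hx, s, rfl⟩ := E.presheaf.exists_le_germ_eq t hU
    have h1 := TopCat.Presheaf.germ_stalkSpecializes_apply E.presheaf hx
      (genPt_specializes (inftyPt k)) s
    have h2 : θ (E.presheaf.stalkSpecializes (genPt_specializes (inftyPt k))
        (E.presheaf.germ W _ hx s)) = genVal θ (genPt_mem W _ hx) s := congrArg θ h1
    simp only [SetLike.mem_coe]
    rw [h2, hθ.genVal_eq_sum he hW]
    exact sum_smul_mem _ (fun i => Submodule.subset_span (Set.mem_range_self i))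
      fun i => expand_mem_intRing _ hx _
  · rw [Submodule.span_le]
    rintro _ ⟨i, rfl⟩
    refine Submodule.subset_span ⟨E.presheaf.germ U _ hU (e i), ?_⟩
    exact congrArg θ (TopCat.Presheaf.germ_stalkSpecializes_apply E.presheaf hU
      (genPt_specializes (inftyPt k)) (e i))

end GenericFibre

/-! ### Embeddings of the generic stalk given by a local basis -/

section FrameMap

variable {k : Type u} [Field k] {E : (P1 k).Modules} {U W : (P1 k).Opens}
  {V : Type v} [AddCommGroup V] [Module (LaurentSeries k) V] {ι : Type*} [Fintype ι]
  {e : ι → Γ(E, U)}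

theorem IsLocalBasis.frame_eq (he : IsLocalBasis e) (w : ι → V) {W' : (P1 k).Opens} (h : W ≤ U)
    (h' : W' ≤ U) (hW : genPt k ∈ W) (hW' : genPt k ∈ W') {s : Γ(E, W)} {s' : Γ(E, W')}
    (hs : E.presheaf.germ W _ hW s = E.presheaf.germ W' _ hW' s') :
    ∑ i, expand W hW (he.coord h s i) • w i = ∑ i, expand W' hW' (he.coord h' s' i) • w i := by
  obtain ⟨O, hO, hOW, hOW', hres⟩ := exists_res_eq_of_germ_eq hW hW' hs
  refine Finset.sum_congr rfl fun i _ => ?_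
  have h1 : expand W hW (he.coord h s i) =
      expand O hO (he.coord (hOW.trans h) (res E hOW s) i) := by
    rw [he.coord_res h hOW s i]
    rfl
  have h2 : expand W' hW' (he.coord h' s' i) =
      expand O hO (he.coord (hOW'.trans h') (res E hOW' s') i) := by
    rw [he.coord_res h' hOW' s' i]
    rfl
  rw [h1, h2, hres]

theorem exists_germ_of_mem (hU : genPt k ∈ U) (t : E.presheaf.stalk (genPt k)) :
    ∃ (W : (P1 k).Opens) (_ : W ≤ U) (hW : genPt k ∈ W) (s : Γ(E, W)),
      E.presheaf.germ W _ hW s = t := by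
  obtain ⟨W, hW, hx, s, hs⟩ := E.presheaf.exists_le_germ_eq t hU
  exact ⟨W, hW, hx, s, hs⟩

theorem IsLocalBasis.exists_frameMap (he : IsLocalBasis e) (hU : genPt k ∈ U) (w : ι → V) :
    ∃ θ : E.presheaf.stalk (genPt k) →+ V, ∀ (W : (P1 k).Opens) (h : W ≤ U) (hW : genPt k ∈ W)
      (s : Γ(E, W)), genVal θ hW s = ∑ i, expand W hW (he.coord h s i) • w i := by
  choose W hWU hW s hs using exists_germ_of_mem (E := E) hU
  refine ⟨AddMonoidHom.mk' (fun t => ∑ i, expand _ (hW t) (he.coord (hWU t) (s t) i) • w i)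
    fun t t' => ?_, fun O hO hηO x => he.frame_eq w _ _ _ _ (hs _)⟩
  have hη : genPt k ∈ W t ⊓ W t' := ⟨hW t, hW t'⟩
  have h1 : E.presheaf.germ _ _ hη (res E inf_le_left (s t) + res E inf_le_right (s t')) =
      t + t' := by
    rw [map_add, germ_res_eq, germ_res_eq, hs, hs]
  rw [he.frame_eq w (hWU (t + t')) (inf_le_left.trans (hWU t)) (hW _) hη ((hs _).trans h1.symm),
    he.frame_eq w (hWU t) (inf_le_left.trans (hWU t)) (hW t) hη
      (germ_res_eq inf_le_left _ hη _).symm,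
    he.frame_eq w (hWU t') (inf_le_left.trans (hWU t)) (hW t') hη
      (germ_res_eq inf_le_right _ hη _).symm, he.coord_add, ← Finset.sum_add_distrib]
  refine Finset.sum_congr rfl fun i _ => ?_
  rw [← add_smul, ← map_add]
  rfl

/-- The map from the generic stalk to `V` that is linear over `k(T)` and sends the germs of a local
basis to given vectors `w i`. -/
def IsLocalBasis.frameMap (he : IsLocalBasis e) (hU : genPt k ∈ U) (w : ι → V) :
    E.presheaf.stalk (genPt k) →+ V := (he.exists_frameMap hU w).choose

theorem IsLocalBasis.genVal_frameMap (he : IsLocalBasis e) (hU : genPt k ∈ U) (w : ι → V)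
    (h : W ≤ U) (hW : genPt k ∈ W) (s : Γ(E, W)) :
    genVal (he.frameMap hU w) hW s = ∑ i, expand W hW (he.coord h s i) • w i :=
  (he.exists_frameMap hU w).choose_spec W h hW s

theorem IsLocalBasis.genVal_frameMap_self (he : IsLocalBasis e) (hU : genPt k ∈ U) (w : ι → V)
    (i : ι) : genVal (he.frameMap hU w) hU (e i) = w i := by
  classical
  rw [he.genVal_frameMap hU w le_rfl, he.coord_self, Finset.sum_eq_single i]
  · rw [Pi.single_eq_same, map_one, one_smul]
  · intro j _ hj
    rw [Pi.single_eq_of_ne hj, map_zero, zero_smul]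
  · simp

theorem IsLocalBasis.isSemilinear_frameMap (he : IsLocalBasis e) (hU : genPt k ∈ U) (w : ι → V) :
    IsSemilinear (he.frameMap hU w) := by
  intro O hO f s
  change genVal _ hO _ = _ • genVal _ hO _
  have hη : genPt k ∈ O ⊓ U := ⟨hO, hU⟩
  rw [← genVal_res inf_le_left hη, ← genVal_res (inf_le_left : O ⊓ U ≤ O) hη s, res_smul,
    he.genVal_frameMap hU w inf_le_right, he.genVal_frameMap hU w inf_le_right, he.coord_smul,
    Finset.smul_sum]
  refine Finset.sum_congr rfl fun i _ => ?_
  rw [Pi.smul_apply, smul_eq_mul, map_mul, mul_smul]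
  rfl

theorem IsLocalBasis.frameMap_injective (he : IsLocalBasis e) (hU : genPt k ∈ U) {w : ι → V}
    (hw : LinearIndependent (LaurentSeries k) w) : Function.Injective (he.frameMap hU w) := by
  rw [injective_iff_map_eq_zero]
  intro t ht
  obtain ⟨W, hWU, hW, s, rfl⟩ := exists_germ_of_mem hU t
  have h1 := he.genVal_frameMap hU w hWU hW s
  have h2 : genVal (he.frameMap hU w) hW s = 0 := ht
  rw [h2] at h1
  have h3 := Fintype.linearIndependent_iff.1 hw _ h1.symm
  have h4 : s = 0 := by
    rw [← he.sum_coord hWU s]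
    refine Finset.sum_eq_zero fun i _ => ?_
    rw [(injective_iff_map_eq_zero _).1 (expand_injective W hW) _ (h3 i), zero_smul]
  rw [h4, map_zero]

end FrameMap

/-! ### Sections over the affine chart -/

section AffineChart

variable {k : Type u} [Field k]

/-- Functions on `D(f)` become regular on `U` after multiplication by a power of `f`. -/
theorem exists_expand_eq_pow_mul {U : (P1 k).Opens} (hU : IsAffineOpen U) (f : Γ(P1 k, U))
    (hf : genPt k ∈ (P1 k).basicOpen f) (hη : genPt k ∈ U) {ι : Type*} [Finite ι]
    (c : ι → Γ(P1 k, (P1 k).basicOpen f)) : ∃ (N : ℕ) (a : ι → Γ(P1 k, U)),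
      ∀ i, expand U hη (a i) = expand U hη f ^ N * expand _ hf (c i) := by
  have := hU.isLocalization_basicOpen f
  have h : ∀ i, ∃ (N : ℕ) (a : Γ(P1 k, U)),
      expand U hη a = expand U hη f ^ N * expand _ hf (c i) := by
    intro i
    obtain ⟨N, a, ha⟩ := IsLocalization.Away.surj f (c i)
    refine ⟨N, a, ?_⟩
    have h1 := congrArg (expand _ hf) ha
    rw [map_mul, map_pow] at h1
    exact h1.symm.trans (mul_comm _ _)
  choose N a ha using h
  cases nonempty_fintype ι
  refine ⟨∑ i, N i, fun i => f ^ (∑ i, N i - N i) * a i, fun i => ?_⟩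
  rw [map_mul, map_pow, ha, ← mul_assoc, ← pow_add, Nat.sub_add_cancel
    (Finset.single_le_sum (fun _ _ => Nat.zero_le _) (Finset.mem_univ i))]

variable {E : (P1 k).Modules} {d : ℕ}

/-- The affine chart is covered by finitely many principal open sets on which the bundle is free. -/
theorem IsVectorBundle.exists_finset (hE : IsVectorBundle d E) :
    ∃ t : Finset Γ(P1 k, finChart k), Ideal.span (t : Set Γ(P1 k, finChart k)) = ⊤ ∧
      ∀ g ∈ t, genPt k ∈ (P1 k).basicOpen g ∧
        ∃ e : Fin d → Γ(E, (P1 k).basicOpen g), IsLocalBasis e := by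
  let S : Set Γ(P1 k, finChart k) := {g | genPt k ∈ (P1 k).basicOpen g ∧
    ∃ e : Fin d → Γ(E, (P1 k).basicOpen g), IsLocalBasis e}
  have hS : Ideal.span S = ⊤ := by
    rw [← isAffineOpen_finChart.iSup_basicOpen_eq_self_iff]
    refine le_antisymm (iSup_le fun g => (P1 k).basicOpen_le _) fun x hx => ?_
    obtain ⟨U, hxU, e, he⟩ := hE.exists_isLocalBasis x
    obtain ⟨g, hg, hxg⟩ := isAffineOpen_finChart.exists_basicOpen_le ⟨x, hxU⟩ hx
    exact Opens.mem_iSup.2 ⟨⟨g, genPt_mem _ x hxg, _, he.restrict hg⟩, hxg⟩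
  obtain ⟨t, htS, ht⟩ := (Ideal.span_eq_top_iff_finite S).1 hS
  exact ⟨t, ht, fun g hg => htS hg⟩

theorem exists_mem_basicOpen_of_span_eq_top {t : Finset Γ(P1 k, finChart k)}
    (ht : Ideal.span (t : Set Γ(P1 k, finChart k)) = ⊤) {x : P1 k} (hx : x ∈ finChart k) :
    ∃ g ∈ t, x ∈ (P1 k).basicOpen g := by
  rw [← isAffineOpen_finChart.iSup_basicOpen_eq_self_iff] at ht
  rw [← ht] at hx
  obtain ⟨g, hg⟩ := Opens.mem_iSup.1 hx
  exact ⟨g.1, g.2, hg⟩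

variable {V : Type v} [AddCommGroup V] [Module (LaurentSeries k) V]
  {θ : E.presheaf.stalk (genPt k) →+ V}

/-- A section over `D(f)` extends to the affine chart after multiplication by a power of `f`. -/
theorem exists_genVal_eq_pow_smul (hE : IsVectorBundle d E) (hθ : IsSemilinear θ)
    (hinj : Function.Injective θ) (f : Γ(P1 k, finChart k))
    (hf : genPt k ∈ (P1 k).basicOpen f) (s : Γ(E, (P1 k).basicOpen f)) :
    ∃ (N : ℕ) (t : Γ(E, finChart k)), genVal θ genPt_mem_finChart t =
      expand _ genPt_mem_finChart f ^ N • genVal θ hf s := by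
  obtain ⟨t, ht, hbasis⟩ := hE.exists_finset
  have hloc : ∀ g ∈ t, ∃ (N : ℕ) (hg : genPt k ∈ (P1 k).basicOpen g)
      (r : Γ(E, (P1 k).basicOpen g)), genVal θ hg r =
      expand _ genPt_mem_finChart f ^ N • genVal θ hf s := by
    intro g hg
    obtain ⟨hηg, e, he⟩ := hbasis g hg
    set f' := resFun ((P1 k).basicOpen_le g) f with hf'
    have hD : (P1 k).basicOpen f' = (P1 k).basicOpen g ⊓ (P1 k).basicOpen f :=
      (P1 k).basicOpen_res f (homOfLE ((P1 k).basicOpen_le g)).op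
    have hηD : genPt k ∈ (P1 k).basicOpen f' := hD ▸ ⟨hηg, hf⟩
    have hDf : (P1 k).basicOpen f' ≤ (P1 k).basicOpen f := hD ▸ inf_le_right
    obtain ⟨N, a, ha⟩ := exists_expand_eq_pow_mul (isAffineOpen_finChart.basicOpen g) f' hηD hηg
      fun j => he.coord ((P1 k).basicOpen_le f') (res E hDf s) j
    refine ⟨N, hηg, ∑ j, a j • e j, ?_⟩
    rw [map_sum, ← genVal_res hDf hηD s,
      hθ.genVal_eq_sum he ((P1 k).basicOpen_le f') hηD (res E hDf s), Finset.smul_sum]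
    refine Finset.sum_congr rfl fun j _ => ?_
    rw [hθ.genVal_smul, ha, mul_smul]
    rfl
  choose! N hg r hr using hloc
  refine ⟨∑ g ∈ t, N g, exists_genVal_eq_of_locally hE hinj _ _ fun x hx => ?_⟩
  obtain ⟨g, hgt, hxg⟩ := exists_mem_basicOpen_of_span_eq_top ht hx
  refine ⟨_, hxg, (P1 k).basicOpen_le g,
    resFun ((P1 k).basicOpen_le g) f ^ (∑ g ∈ t, N g - N g) • r g, ?_⟩
  rw [hθ.genVal_smul, hr g hgt, map_pow, ← mul_smul, ← Nat.sub_add_cancel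
    (Finset.single_le_sum (fun _ _ => Nat.zero_le _) hgt : N g ≤ ∑ g ∈ t, N g), pow_add,
    Nat.add_sub_cancel]
  rfl

end AffineChart

/-! ### A vector bundle is determined by its pair of lattices -/

section Comparison

variable {k : Type u} [Field k] {V : Type v} [AddCommGroup V] [Module (LaurentSeries k) V]
  {E F : (P1 k).Modules} {d d' : ℕ} {θ : E.presheaf.stalk (genPt k) →+ V}
  {θ' : F.presheaf.stalk (genPt k) →+ V}

theorem exists_regular_family {U U' : (P1 k).Opens} (hU : genPt k ∈ U) {ι : Type*} [Finite ι]
    (f : ι → Γ(P1 k, U)) (h : ∀ i, expand U hU (f i) ∈ intRing k) (hU' : inftyPt k ∈ U') :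
    ∃ (W : (P1 k).Opens) (_ : inftyPt k ∈ W) (_ : W ≤ U') (g : ι → Γ(P1 k, W)),
      ∀ hW i, expand W hW (g i) = expand U hU (f i) := by
  cases nonempty_fintype ι
  choose W hW hWU g hg using fun i => exists_expand_eq hU (f i) (h i) hU'
  have hle : ∀ i, U' ⊓ Finset.univ.inf W ≤ W i := fun i =>
    inf_le_right.trans (Finset.inf_le (Finset.mem_univ i))
  refine ⟨U' ⊓ Finset.univ.inf W, ⟨hU', ?_⟩, inf_le_left, fun i => resFun (hle i) (g i), ?_⟩
  · have : ∀ t : Finset ι, inftyPt k ∈ t.inf W := fun t =>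
      Finset.inf_induction (p := fun O => inftyPt k ∈ O) trivial
        (fun _ h _ h' => ⟨h, h'⟩) fun i _ => hW i
    exact this _
  · intro hη i
    exact hg i (hle i hη)

/-- If `E` and `F` give the same lattices, then every section of `E` has the same value in `V` as a
section of `F`. On the affine chart a section extends to the whole chart up to a power of some `f`;
at infinity, the coordinates in a local basis of `F` are rational functions that lie in `k[[π]]`. -/
theorem exists_genVal_eq (hE : IsVectorBundle d E) (hF : IsVectorBundle d' F)
    (hd : Module.finrank (LaurentSeries k) V = d')
    (hθ : IsSemilinear θ) (hinj : Function.Injective θ)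
    (hθ' : IsSemilinear θ') (hinj' : Function.Injective θ')
    (hL : Set.range (genVal θ genPt_mem_finChart) ⊆ Set.range (genVal θ' genPt_mem_finChart))
    {M : Submodule (intRing k) V} (hM : IsLattice M)
    (hME : M = Submodule.span (intRing k) (Set.range fun t : E.presheaf.stalk (inftyPt k) =>
      θ (E.presheaf.stalkSpecializes (genPt_specializes (inftyPt k)) t)))
    (hMF : M = Submodule.span (intRing k) (Set.range fun t : F.presheaf.stalk (inftyPt k) =>
      θ' (F.presheaf.stalkSpecializes (genPt_specializes (inftyPt k)) t)))
    {U : (P1 k).Opens} (hU : genPt k ∈ U) (s : Γ(E, U)) :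
    ∃ t : Γ(F, U), genVal θ' hU t = genVal θ hU s := by
  have hext : ∀ x ∈ U ⊓ finChart k, ∃ (f : Γ(P1 k, finChart k)) (hf : genPt k ∈ (P1 k).basicOpen f)
      (_ : x ∈ (P1 k).basicOpen f) (_ : (P1 k).basicOpen f ≤ U) (g : Γ(P1 k, (P1 k).basicOpen f))
      (t : Γ(F, finChart k)), genVal θ hU s = expand _ hf g • genVal θ' genPt_mem_finChart t := by
    intro x hx
    obtain ⟨f, hfU, hxf⟩ := isAffineOpen_finChart.exists_basicOpen_le ⟨x, hx.1⟩ hx.2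
    have hf := genPt_mem _ x hxf
    obtain ⟨N, t, ht⟩ := exists_genVal_eq_pow_smul hE hθ hinj f hf (res E hfU s)
    obtain ⟨t', ht'⟩ := hL ⟨t, rfl⟩
    have hunit : IsUnit (resFun ((P1 k).basicOpen_le f) f) :=
      RingedSpace.isUnit_res_basicOpen _ f
    obtain ⟨g, hg⟩ := hunit.exists_left_inv
    refine ⟨f, hf, hxf, hfU, g ^ N, t', ?_⟩
    rw [ht', ht, ← mul_smul, map_pow]
    have h1 : expand _ hf g * expand _ genPt_mem_finChart f = 1 := by
      rw [← expand_map ((P1 k).basicOpen_le f) hf f, ← map_mul]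
      exact (congrArg _ hg).trans (map_one _)
    rw [← mul_pow, h1, one_pow, one_smul, genVal_res]
  refine exists_genVal_eq_of_locally hF hinj' hU _ fun x hx => ?_
  by_cases hxA : x ∈ finChart k
  · obtain ⟨f, hf, hxf, hfU, g, t, ht⟩ := hext x ⟨hx, hxA⟩
    refine ⟨_, hxf, hfU, g • res F ((P1 k).basicOpen_le f) t, ?_⟩
    rw [hθ'.genVal_smul, genVal_res, ht]
  · obtain rfl := eq_inftyPt_of_notMem_finChart hxA
    obtain ⟨U', hU', e, he⟩ := hF.exists_isLocalBasis (inftyPt k)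
    have hη' := genPt_mem U' _ hU'
    have hMe := hMF.trans (span_stalk_inftyPt hθ' he hU')
    have hli : LinearIndependent (LaurentSeries k) fun i => genVal θ' hη' (e i) := by
      refine linearIndependent_of_top_le_span_of_card_eq_finrank ?_ (by rw [hd, Fintype.card_fin])
      obtain ⟨b, hb⟩ := hM
      rw [← b.span_eq, Submodule.span_le]
      rintro _ ⟨i, rfl⟩
      have h1 : b i ∈ M := hb ▸ Submodule.subset_span ⟨i, rfl⟩
      rw [hMe] at h1
      obtain ⟨c, -, hc⟩ := exists_coeff_of_mem_span h1
      rw [hc]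
      exact sum_mem fun j _ => Submodule.smul_mem _ _ (Submodule.subset_span ⟨j, rfl⟩)
    have hsM : genVal θ hU s ∈ M := by
      rw [hME]
      refine Submodule.subset_span ⟨E.presheaf.germ U _ hx s, ?_⟩
      exact congrArg θ (TopCat.Presheaf.germ_stalkSpecializes_apply E.presheaf hx
        (genPt_specializes (inftyPt k)) s)
    rw [hMe] at hsM
    obtain ⟨a, ha, hsa⟩ := exists_coeff_of_mem_span hsM
    obtain ⟨f, hf, -, hfU, g, t, ht⟩ := hext (genPt k) ⟨hU, genPt_mem_finChart⟩
    -- The coordinates of the section are rational functions.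
    set W := (P1 k).basicOpen f ⊓ U' with hW
    have hηW : genPt k ∈ W := ⟨hf, hη'⟩
    have hWA : W ≤ finChart k := inf_le_left.trans ((P1 k).basicOpen_le f)
    have hWf : W ≤ (P1 k).basicOpen f := inf_le_left
    set c : Fin d' → Γ(P1 k, W) := fun i =>
      resFun hWf g * he.coord (inf_le_right : W ≤ U') (res F hWA t) i with hc
    have hac : ∀ i, expand W hηW (c i) = a i := by
      have h1 : ∑ i, expand W hηW (c i) • genVal θ' hη' (e i) = ∑ i, a i • genVal θ' hη' (e i) := by
        rw [← hsa, ht, ← genVal_res hWA hηW t, hθ'.genVal_eq_sum he inf_le_right hηW,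
          Finset.smul_sum]
        refine Finset.sum_congr rfl fun i _ => ?_
        rw [hc, map_mul, mul_smul]
        rfl
      exact congrFun (linearIndependent_iff_injective_fintypeLinearCombination.1 hli
        (by simpa [Fintype.linearCombination_apply] using h1))
    obtain ⟨O, hO, hOle, b, hb⟩ := exists_regular_family (U' := U ⊓ U') hηW c
      (fun i => hac i ▸ ha i) ⟨hx, hU'⟩
    refine ⟨O, hO, hOle.trans inf_le_left,
      ∑ i, b i • res F (hOle.trans inf_le_right) (e i), ?_⟩
    rw [map_sum, hsa]
    refine Finset.sum_congr rfl fun i _ => ?_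
    rw [hθ'.genVal_smul, genVal_res, hb, hac]

end Comparison

section Isomorphism

variable {k : Type u} [Field k] {V : Type v} [AddCommGroup V]
  {E F : (P1 k).Modules} {d d' : ℕ} {θ : E.presheaf.stalk (genPt k) →+ V}
  {θ' : F.presheaf.stalk (genPt k) →+ V}

theorem subsingleton_of_genPt_notMem (F : (P1 k).Modules) {U : (P1 k).Opens} (hU : genPt k ∉ U) :
    Subsingleton Γ(F, U) :=
  ⟨fun _ _ => eq_of_locally_res_eq fun x hx => absurd (genPt_mem U x hx) hU⟩

theorem exists_addMonoidHom (hF : IsVectorBundle d' F) (hinj' : Function.Injective θ')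
    (h : ∀ (U : (P1 k).Opens) (hU : genPt k ∈ U) (s : Γ(E, U)),
      ∃ t : Γ(F, U), genVal θ' hU t = genVal θ hU s) (U : (P1 k).Opens) :
    ∃ φ : Γ(E, U) →+ Γ(F, U), ∀ (hU : genPt k ∈ U) s, genVal θ' hU (φ s) = genVal θ hU s := by
  by_cases hU : genPt k ∈ U
  · choose φ hφ using h U hU
    refine ⟨AddMonoidHom.mk' φ fun s t => genVal_injective hF hinj' hU ?_, fun _ s => hφ s⟩
    rw [map_add, hφ, hφ, hφ, map_add]
  · exact ⟨0, fun h => absurd h hU⟩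

variable [Module (LaurentSeries k) V]

theorem exists_hom (hF : IsVectorBundle d' F) (hθ : IsSemilinear θ)
    (hθ' : IsSemilinear θ') (hinj' : Function.Injective θ')
    (h : ∀ (U : (P1 k).Opens) (hU : genPt k ∈ U) (s : Γ(E, U)),
      ∃ t : Γ(F, U), genVal θ' hU t = genVal θ hU s) :
    ∃ φ : E ⟶ F, ∀ (U : (P1 k).Opens) (hU : genPt k ∈ U) (s : Γ(E, U)),
      genVal θ' hU ((φ.app U).hom s) = genVal θ hU s := by
  choose φ hφ using exists_addMonoidHom hF hinj' h
  have hnat : ∀ {U W : (P1 k).Opens} (hWU : W ≤ U) (s : Γ(E, U)),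
      φ W (res E hWU s) = res F hWU (φ U s) := by
    intro U W hWU s
    by_cases hW : genPt k ∈ W
    · apply genVal_injective hF hinj' hW
      rw [hφ, genVal_res, genVal_res, hφ]
    · exact (subsingleton_of_genPt_notMem F hW).elim _ _
  have hsmul : ∀ (U : (P1 k).Opens) (f : Γ(P1 k, U)) (s : Γ(E, U)), φ U (f • s) = f • φ U s := by
    intro U f s
    by_cases hU : genPt k ∈ U
    · apply genVal_injective hF hinj' hU
      rw [hφ, hθ.genVal_smul, hθ'.genVal_smul, hφ]
    · exact (subsingleton_of_genPt_notMem F hU).elim _ _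
  let ψ : E.val.presheaf ⟶ F.val.presheaf :=
    { app := fun U => AddCommGrpCat.ofHom (φ U.unop)
      naturality := fun U W i => by
        ext s
        exact hnat i.unop.le s }
  exact ⟨⟨PresheafOfModules.homMk ψ fun U f s => hsmul U.unop f s⟩, fun U hU s => hφ U hU s⟩

theorem nonempty_iso (hE : IsVectorBundle d E) (hF : IsVectorBundle d' F) (hθ : IsSemilinear θ)
    (hinj : Function.Injective θ) (hθ' : IsSemilinear θ') (hinj' : Function.Injective θ')
    (h : ∀ (U : (P1 k).Opens) (hU : genPt k ∈ U) (s : Γ(E, U)),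
      ∃ t : Γ(F, U), genVal θ' hU t = genVal θ hU s)
    (h' : ∀ (U : (P1 k).Opens) (hU : genPt k ∈ U) (t : Γ(F, U)),
      ∃ s : Γ(E, U), genVal θ hU s = genVal θ' hU t) : Nonempty (E ≅ F) := by
  obtain ⟨φ, hφ⟩ := exists_hom hF hθ hθ' hinj' h
  obtain ⟨ψ, hψ⟩ := exists_hom hE hθ' hθ hinj h'
  refine ⟨⟨φ, ψ, ?_, ?_⟩⟩
  · ext U s
    by_cases hU : genPt k ∈ U
    · exact genVal_injective hE hinj hU ((hψ U hU _).trans (hφ U hU s))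
    · exact (subsingleton_of_genPt_notMem E hU).elim _ _
  · ext U s
    by_cases hU : genPt k ∈ U
    · exact genVal_injective hF hinj' hU ((hφ U hU _).trans (hψ U hU s))
    · exact (subsingleton_of_genPt_notMem F hU).elim _ _

/-- A vector bundle is determined up to isomorphism by its pair of lattices. -/
theorem IsAssociated.nonempty_iso {L : Submodule (polyRing k) V} {M : Submodule (intRing k) V}
    (hM : IsLattice M) (hE : IsAssociated E L M) (hF : IsAssociated F L M) : Nonempty (E ≅ F) := by
  obtain ⟨hEb, θ, hinj, hθ, hL, hME⟩ := hE
  obtain ⟨hFb, θ', hinj', hθ', hL', hMF⟩ := hF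
  have hLL : Set.range (genVal θ genPt_mem_finChart) = Set.range (genVal θ' genPt_mem_finChart) :=
    hL.symm.trans hL'
  exact SplitP1.nonempty_iso hEb hFb hθ hinj hθ' hinj'
    (fun U hU s => exists_genVal_eq hEb hFb rfl hθ hinj hθ' hinj' hLL.subset hM hME hMF hU s)
    (fun U hU s => exists_genVal_eq hFb hEb rfl hθ' hinj' hθ hinj hLL.symm.subset hM hMF hME hU s)

end Isomorphism

/-! ### Direct sums of twisting sheaves -/

section LineBundles

/-- The section `g` of `F` over `U` is a basis of `F|_U`. -/
def IsLocalGenerator {X : Scheme.{u}} {F : X.Modules} {U : X.Opens} (g : Γ(F, U)) : Prop :=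
  ∀ (W : X.Opens) (h : W ≤ U), Function.Bijective fun c : Γ(X, W) => c • res F h g

theorem app_res {X : Scheme.{u}} {E F : X.Modules} (φ : E ⟶ F) {U W : X.Opens} (h : W ≤ U)
    (s : Γ(E, U)) : (φ.app W).hom (res E h s) = res F h ((φ.app U).hom s) :=
  congrArg (fun ψ => ψ.hom s) (φ.mapPresheaf.naturality (homOfLE h).op)

theorem app_smul {X : Scheme.{u}} {E F : X.Modules} (φ : E ⟶ F) {U : X.Opens} (c : Γ(X, U))
    (s : Γ(E, U)) : (φ.app U).hom (c • s) = c • (φ.app U).hom s :=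
  φ.app_smul c s

theorem sum_app {X : Scheme.{u}} {E F : X.Modules} {U : X.Opens} {I : Type*} (t : Finset I)
    (φ : I → (E ⟶ F)) (s : Γ(E, U)) :
    ((∑ i ∈ t, φ i).app U).hom s = ∑ i ∈ t, ((φ i).app U).hom s := by
  classical
  induction t using Finset.induction_on with
  | empty => rfl
  | insert a t ha ih =>
    rw [Finset.sum_insert ha, Finset.sum_insert ha, ← ih]
    rfl

/-- In a direct sum, generators of the summands form a basis. -/
theorem isLocalBasis_biproduct {X : Scheme.{u}} {d : ℕ} (F : Fin d → X.Modules)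
    [HasBiproduct F] {U : X.Opens} {g : ∀ i, Γ(F i, U)}
    (hg : ∀ i, IsLocalGenerator (g i)) :
    IsLocalBasis fun i => ((biproduct.ι F i).app U).hom (g i) := by
  intro W h
  have hπι : ∀ (i j) (s : Γ(F j, W)), i ≠ j →
      ((biproduct.π F i).app W).hom (((biproduct.ι F j).app W).hom s) = 0 := by
    intro i j s hij
    exact congrArg (fun φ => (Scheme.Modules.Hom.app φ W).hom s) (biproduct.ι_π_ne F hij.symm)
  have hπι' : ∀ (j) (s : Γ(F j, W)),
      ((biproduct.π F j).app W).hom (((biproduct.ι F j).app W).hom s) = s := by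
    intro j s
    exact congrArg (fun φ => (Scheme.Modules.Hom.app φ W).hom s) (biproduct.ι_π_self F j)
  have hπ : ∀ (c : Fin d → Γ(X, W)) i, ((biproduct.π F i).app W).hom
      (∑ j, c j • res (⨁ F) h (((biproduct.ι F j).app U).hom (g j))) = c i • res (F i) h (g i) := by
    intro c i
    rw [map_sum, Finset.sum_eq_single i]
    · rw [← app_res, app_smul, hπι']
    · intro j _ hj
      rw [← app_res, app_smul, hπι _ _ _ hj.symm, smul_zero]
    · simp
  constructor
  · intro c c' hcc
    funext i
    have h1 := congrArg ((biproduct.π F i).app W).hom hcc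
    dsimp only at h1
    rw [hπ, hπ] at h1
    exact (hg i W h).1 h1
  · intro s
    choose c hc using fun i => (hg i W h).2 (((biproduct.π F i).app W).hom s)
    refine ⟨c, ?_⟩
    have h1 := congrArg (fun φ => (Scheme.Modules.Hom.app φ W).hom s) (biproduct.total (f := F))
    rw [sum_app] at h1
    refine Eq.trans (Finset.sum_congr rfl fun i _ => ?_) h1
    rw [← app_res, ← app_smul]
    exact congrArg ((biproduct.ι F i).app W).hom (hc i)

variable {k : Type u} [Field k]

theorem X_notMem_of_mem {i : Fin 2} {U : (P1 k).Opens}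
    (hU : U ≤ Proj.basicOpen (grading k) (MvPolynomial.X i)) (m : ℕ) (x : U) :
    (MvPolynomial.X i ^ m : Coord k) ∉ x.1.asHomogeneousIdeal :=
  fun h => hU x.2 (x.1.isPrime.mem_of_pow_mem m h)

theorem X_pow_mem_grading (i : Fin 2) (m : ℕ) : (MvPolynomial.X i ^ m : Coord k) ∈ grading k m := by
  simpa using (MvPolynomial.isHomogeneous_X k i).pow m

/-- The generator `X_i ^ n` of `𝒪(n)` on the chart `X_i ≠ 0`, written as a fraction in which the
numerator or the denominator is `1`. -/
def twistGen (k : Type u) [Field k] (n : ℤ) (i : Fin 2) :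
    Γ(twist k n, Proj.basicOpen (grading k) (MvPolynomial.X i)) :=
  (⟨fun x => Localization.mk (MvPolynomial.X i ^ n.toNat)
      ⟨MvPolynomial.X i ^ (-n).toNat, X_notMem_of_mem le_rfl _ x⟩,
    fun x => ⟨_, x.2, 𝟙 _, n.toNat, (-n).toNat, _, _, by omega, X_pow_mem_grading i _,
      X_pow_mem_grading i _, fun y => X_notMem_of_mem le_rfl _ y, fun _ => rfl⟩⟩ :
    twistSections (k := k) n (Proj.basicOpen (grading k) (MvPolynomial.X i)))

theorem isUnit_twistGen (n : ℤ) (i : Fin 2) (x : Proj.basicOpen (grading k) (MvPolynomial.X i)) :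
    IsUnit ((twistGen k n i).1 x) := by
  refine IsUnit.of_mul_eq_one (Localization.mk (MvPolynomial.X i ^ (-n).toNat)
      ⟨MvPolynomial.X i ^ n.toNat, X_notMem_of_mem le_rfl _ x⟩) ?_
  refine (Localization.mk_mul ..).trans ?_
  rw [← Localization.mk_one, Localization.mk_eq_mk_iff, Localization.r_iff_exists]
  exact ⟨1, by simp only [Submonoid.coe_one, one_mul, Submonoid.coe_mul, mul_one]; ring⟩

/-- The ring of homogeneous fractions of degree zero that are defined at the point `x`. -/
abbrev FracAt (x : ProjectiveSpectrum (grading k)) : Type u :=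
  HomogeneousLocalization.AtPrime (grading k) x.asHomogeneousIdeal.toIdeal

theorem isLocalGenerator_twistGen (n : ℤ) (i : Fin 2) : IsLocalGenerator (twistGen k n i) := by
  intro W hW
  constructor
  · intro c c' h
    refine Subtype.ext (funext fun x => HomogeneousLocalization.val_injective _ ?_)
    have h1 : (c.1 x).val * (twistGen k n i).1 ⟨x.1, hW x.2⟩ =
        (c'.1 x).val * (twistGen k n i).1 ⟨x.1, hW x.2⟩ := congrFun (congrArg Subtype.val h) x
    exact (isUnit_twistGen n i ⟨x.1, hW x.2⟩).mul_left_injective h1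
  · intro f
    have key : ∀ x : W, ∃ (V : Opens (ProjectiveSpectrum.top (grading k))) (_ : x.1 ∈ V)
        (j : V ⟶ W) (c : ∀ y : V, FracAt y.1),
        ProjectiveSpectrum.StructureSheaf.IsFraction c ∧
        ∀ y : V, (c y).val * (twistGen k n i).1 ⟨y.1, hW (j.le y.2)⟩ = f.1 ⟨y.1, j.le y.2⟩ := by
      intro x
      obtain ⟨V, hV, j, a, b, r, s, hab, hr, hs, hsV, hf⟩ := f.2 x
      have hr' : r * MvPolynomial.X i ^ (-n).toNat ∈ grading k (a + (-n).toNat) :=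
        SetLike.mul_mem_graded hr (X_pow_mem_grading i _)
      have hs' : s * MvPolynomial.X i ^ n.toNat ∈ grading k (a + (-n).toNat) := by
        rw [show a + (-n).toNat = b + n.toNat by omega]
        exact SetLike.mul_mem_graded hs (X_pow_mem_grading i _)
      have hsV' : ∀ y : V, s * MvPolynomial.X i ^ n.toNat ∉ y.1.asHomogeneousIdeal := fun y =>
        (primeCompl y.1).mul_mem (hsV y)
          (X_notMem_of_mem (U := V) (fun z hz => hW (j.le hz)) _ y)
      refine ⟨V, hV, j, fun y => HomogeneousLocalization.mk ⟨_, ⟨_, hr'⟩, ⟨_, hs'⟩, hsV' y⟩,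
        ⟨_, ⟨_, hr'⟩, ⟨_, hs'⟩, hsV', fun y => rfl⟩, fun y => ?_⟩
      refine Eq.trans ?_ (hf y).symm
      refine (Localization.mk_mul ..).trans ?_
      rw [Localization.mk_eq_mk_iff, Localization.r_iff_exists]
      exact ⟨1, by simp only [Submonoid.coe_one, one_mul, Submonoid.coe_mul]; ring⟩
    choose V hV j c hc hcf using key
    refine ⟨(⟨fun x => c x ⟨x.1, hV x⟩, fun x => ⟨V x, hV x, j x, ?_⟩⟩ : funSections W),
      Subtype.ext (funext fun x => hcf x ⟨x.1, hV x⟩)⟩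
    have h1 : (fun y : V x => c ⟨y.1, (j x).le y.2⟩ ⟨y.1, hV ⟨y.1, (j x).le y.2⟩⟩) = c x := by
      funext y
      refine HomogeneousLocalization.val_injective _
        ((isUnit_twistGen n i ⟨y.1, hW ((j x).le y.2)⟩).mul_left_injective ?_)
      exact (hcf ⟨y.1, (j x).le y.2⟩ ⟨y.1, hV _⟩).trans (hcf x y).symm
    exact h1 ▸ hc x

/-- The intersection of the two charts. -/
def overlap (k : Type u) [Field k] : (P1 k).Opens :=
  finChart k ⊓ Proj.basicOpen (grading k) (MvPolynomial.X 1)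

theorem overlap_le_zero : overlap k ≤ Proj.basicOpen (grading k) (MvPolynomial.X 0) := inf_le_left

theorem overlap_le_one : overlap k ≤ Proj.basicOpen (grading k) (MvPolynomial.X 1) := inf_le_right

/-- The transition function `(X₁ / X₀) ^ n` of `𝒪(n)` on the intersection of the two charts. -/
def transition (k : Type u) [Field k] (n : ℤ) : Γ(P1 k, overlap k) :=
  fracSection _ (m := n.toNat + (-n).toNat)
    (SetLike.mul_mem_graded (X_pow_mem_grading 1 n.toNat) (X_pow_mem_grading 0 (-n).toNat))
    (SetLike.mul_mem_graded (X_pow_mem_grading 0 n.toNat) (X_pow_mem_grading 1 (-n).toNat))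
    fun x hx => (primeCompl x).mul_mem (X_notMem_of_mem overlap_le_zero _ ⟨x, hx⟩)
      (X_notMem_of_mem overlap_le_one _ ⟨x, hx⟩)

theorem expand_transition (n : ℤ) (h : genPt k ∈ overlap k) :
    expand _ h (transition k n) = unif k ^ (-n) := by
  refine (expand_fracSection _ _ _ _ h).trans ?_
  simp only [map_mul, map_pow, evalForm_X_zero, evalForm_X_one, one_pow, mul_one, one_mul]
  rw [← zpow_natCast, ← zpow_natCast, ← zpow_sub₀ varT_ne_zero, varT, inv_zpow',
    Int.toNat_sub_toNat_neg]

theorem res_twistGen_one (n : ℤ) :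
    res (twist k n) overlap_le_one (twistGen k n 1) =
      transition k n • res (twist k n) overlap_le_zero (twistGen k n 0) := by
  refine Subtype.ext (funext fun x => Eq.symm ?_)
  refine (Localization.mk_mul ..).trans ?_
  refine Eq.trans ?_ (show Localization.mk _ _ = (twistGen k n 1).1 ⟨x.1, x.2.2⟩ from rfl)
  rw [Localization.mk_eq_mk_iff, Localization.r_iff_exists]
  exact ⟨1, by simp only [Submonoid.coe_one, one_mul, Submonoid.coe_mul]; ring⟩

theorem inftyPt_mem_basicOpen :
    inftyPt k ∈ Proj.basicOpen (grading k) (MvPolynomial.X 1) := by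
  intro h
  have h2 : (MvPolynomial.X 1 : Coord k) ∈ Ideal.span {(MvPolynomial.X 0 : Coord k)} := h
  rw [Ideal.mem_span_singleton, MvPolynomial.X_dvd_X] at h2
  simp at h2

variable {d : ℕ}

/-- The basis of `𝒪(n₁) ⊕ ⋯ ⊕ 𝒪(n_d)` on the chart `X_i ≠ 0` given by the powers of `X_i`. -/
def sumTwistGen (k : Type u) [Field k] (n : Fin d → ℤ) (i : Fin 2) (j : Fin d) :
    Γ(sumTwist k n, Proj.basicOpen (grading k) (MvPolynomial.X i)) :=
  haveI : HasFiniteBiproducts (P1 k).Modules := Abelian.hasFiniteBiproducts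
  ((biproduct.ι (fun j => twist k (n j)) j).app _).hom (twistGen k (n j) i)

theorem isLocalBasis_sumTwistGen (n : Fin d → ℤ) (i : Fin 2) :
    IsLocalBasis (sumTwistGen k n i) :=
  haveI : HasFiniteBiproducts (P1 k).Modules := Abelian.hasFiniteBiproducts
  isLocalBasis_biproduct (fun j => twist k (n j)) fun j => isLocalGenerator_twistGen (n j) i

theorem res_sumTwistGen_one (n : Fin d → ℤ) (j : Fin d) :
    res (sumTwist k n) overlap_le_one (sumTwistGen k n 1 j) =
      transition k (n j) • res (sumTwist k n) overlap_le_zero (sumTwistGen k n 0 j) := by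
  have : HasFiniteBiproducts (P1 k).Modules := Abelian.hasFiniteBiproducts
  refine (app_res (biproduct.ι (fun j => twist k (n j)) j) _ _).symm.trans ?_
  rw [res_twistGen_one, app_smul, app_res]
  rfl

theorem isVectorBundle_sumTwist (n : Fin d → ℤ) : IsVectorBundle d (sumTwist k n) := by
  refine isVectorBundle_of_isLocalBasis fun x => ?_
  by_cases hx : x ∈ finChart k
  · exact ⟨_, hx, _, isLocalBasis_sumTwistGen n 0⟩
  · rw [eq_inftyPt_of_notMem_finChart hx]
    exact ⟨_, inftyPt_mem_basicOpen, _, isLocalBasis_sumTwistGen n 1⟩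

/-- The embedding of the generic fibre of `𝒪(n₁) ⊕ ⋯ ⊕ 𝒪(n_d)` sends the generators on the affine
chart to the basis `π ^ nⱼ vⱼ` of `L`; because of the transition functions it sends the generators
at infinity to the basis `vⱼ` of `M`. -/
theorem IsAdapted.isAssociated_sumTwist {V : Type v} [AddCommGroup V] [Module (LaurentSeries k) V]
    {L : Submodule (polyRing k) V} {M : Submodule (intRing k) V} {v : Fin d → V} {n : Fin d → ℤ}
    (hd : Module.finrank (LaurentSeries k) V = d) (h : IsAdapted L M v n) :
    IsAssociated (sumTwist k n) L M := by
  have he := isLocalBasis_sumTwistGen (k := k) n 0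
  have he' := isLocalBasis_sumTwistGen (k := k) n 1
  set w : Fin d → V := fun j => unif k ^ n j • v j with hw
  have hwind : LinearIndependent (LaurentSeries k) w :=
    linearIndependent_unif_smul (linearIndependent_of_intRing h.1.1) n
  let θ := he.frameMap genPt_mem_finChart w
  have hθ : IsSemilinear θ := he.isSemilinear_frameMap genPt_mem_finChart w
  have hval : ∀ j, genVal θ genPt_mem_finChart (sumTwistGen k n 0 j) = w j :=
    he.genVal_frameMap_self genPt_mem_finChart w
  have hval' : ∀ j, genVal θ (genPt_mem _ _ inftyPt_mem_basicOpen) (sumTwistGen k n 1 j) = v j := by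
    intro j
    have hη : genPt k ∈ overlap k :=
      ⟨genPt_mem_finChart, genPt_mem _ _ inftyPt_mem_basicOpen⟩
    rw [← genVal_res overlap_le_one hη, res_sumTwistGen_one, hθ.genVal_smul, expand_transition]
    refine (congrArg (_ • ·) ((genVal_res overlap_le_zero hη _).trans (hval j))).trans ?_
    rw [hw, smul_smul, zpow_neg, inv_mul_cancel₀ (zpow_ne_zero _ unif_ne_zero), one_smul]
  refine ⟨hd ▸ isVectorBundle_sumTwist n, θ,
    he.frameMap_injective genPt_mem_finChart hwind, hθ, ?_, ?_⟩
  · rw [← h.2.2]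
    apply Set.Subset.antisymm
    · intro x hx
      obtain ⟨c, hc, rfl⟩ := exists_coeff_of_mem_span hx
      simp only [← range_expand_finChart] at hc
      choose f hf using hc
      let g : Fin d → Γ(sumTwist k n, finChart k) := sumTwistGen k n 0
      refine ⟨∑ j, f j • g j, ?_⟩
      change genVal θ genPt_mem_finChart _ = _
      rw [map_sum]
      refine Finset.sum_congr rfl fun j _ => ?_
      rw [← hf j]
      exact (hθ.genVal_smul genPt_mem_finChart _ _).trans (congrArg _ (hval j))
    · rintro _ ⟨s, rfl⟩
      change genVal θ genPt_mem_finChart s ∈ _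
      have hs := hθ.genVal_eq_sum he (le_refl (finChart k)) genPt_mem_finChart s
      rw [hs]
      refine sum_smul_mem _ (fun j => ?_) fun j => ?_
      · exact (hval j).symm ▸ Submodule.subset_span (Set.mem_range_self j)
      · rw [← range_expand_finChart]
        exact ⟨_, rfl⟩
  · rw [span_stalk_inftyPt hθ he' inftyPt_mem_basicOpen, ← h.1.2]
    simp only [hval']

end LineBundles

/-! ### The lattices of a vector bundle -/

section LatticesOfBundle

variable {k : Type u} [Field k] {V : Type v} [AddCommGroup V] [Module (LaurentSeries k) V]

theorem isLattice_of_span_eq_top {R : Subring (LaurentSeries k)} {L : Submodule R V} {r : ℕ}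
    {b : Fin r → V} (hL : L = Submodule.span R (Set.range b))
    (hb : Submodule.span (LaurentSeries k) (Set.range b) = ⊤)
    (hr : r = Module.finrank (LaurentSeries k) V) : IsLattice L := by
  subst hr
  refine ⟨basisOfTopLeSpanOfCardEqFinrank b hb.ge (Fintype.card_fin _), ?_⟩
  rw [coe_basisOfTopLeSpanOfCardEqFinrank, hL]

instance : IsPrincipalIdealRing (polyRing k) :=
  IsPrincipalIdealRing.of_surjective _ (RingHom.rangeRestrict_surjective
    (Polynomial.eval₂RingHom (HahnSeries.C : k →+* LaurentSeries k) (varT k)))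

theorem card_le_of_smul_mem_span {R N : Type*} [CommRing R] [IsDomain R] [AddCommGroup N]
    [Module R N] {r d : ℕ} {b : Fin r → N} (hb : LinearIndependent R b) (w : Fin d → N)
    {q : Fin r → R} (hq : ∀ i, q i ≠ 0)
    (h : ∀ i, q i • b i ∈ Submodule.span R (Set.range w)) : r ≤ d := by
  choose a ha using fun i => (Submodule.mem_span_range_iff_exists_fun R).1 (h i)
  have hli : LinearIndependent R fun i => q i • b i := by
    rw [Fintype.linearIndependent_iff] at hb ⊢
    intro c hc i
    have h1 : c i * q i = 0 := hb (fun i => c i * q i) (by simpa only [mul_smul] using hc) i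
    exact (mul_eq_zero.1 h1).resolve_right (hq i)
  have hli' : LinearIndependent R a := by
    refine LinearIndependent.of_comp (Fintype.linearCombination R w) ?_
    convert hli using 1
    exact funext ha
  have h := hli'.fintype_card_le_finrank
  rwa [Fintype.card_fin, Module.finrank_fin_fun] at h

/-- A finitely generated `A`-submodule that spans `V` is a lattice as soon as its vectors have
coordinates in `k(T)` with respect to some basis of `V`: it is free, and its rank is at most
`dim V` because multiples of its basis vectors lie in the lattice of that basis. -/
theorem isLattice_of_fg {L : Submodule (polyRing k) V} (hfg : L.FG)
    (hspan : Submodule.span (LaurentSeries k) (L : Set V) = ⊤) {d : ℕ}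
    (w : Module.Basis (Fin d) (LaurentSeries k) V)
    (hw : ∀ x ∈ L, ∀ j, ∃ p ∈ polyRing k, p ≠ 0 ∧ p * w.repr x j ∈ polyRing k) : IsLattice L := by
  have : Module.Finite (polyRing k) L := Module.Finite.iff_fg.2 hfg
  have : Module.Finite (LaurentSeries k) V := Module.Finite.of_basis w
  have : Module.IsTorsionFree (polyRing k) L := .of_smul_eq_zero fun c x hcx => by
    have h : (c : LaurentSeries k) • (x : V) = 0 := congrArg Subtype.val hcx
    rcases smul_eq_zero.1 h with h | h
    exacts [Or.inl (Subtype.ext h), Or.inr (Subtype.ext h)]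
  obtain ⟨r, b⟩ := Module.basisOfFiniteTypeTorsionFree' (R := polyRing k) (M := L)
  have hL : L = Submodule.span (polyRing k) (Set.range fun i => (b i : V)) := by
    have h := congrArg (Submodule.map L.subtype) b.span_eq
    rw [Submodule.map_span, ← Set.range_comp, Submodule.map_top, Submodule.range_subtype] at h
    exact h.symm
  have hb : Submodule.span (LaurentSeries k) (Set.range fun i => (b i : V)) = ⊤ := by
    rw [← hspan]
    refine le_antisymm (Submodule.span_mono ?_) (Submodule.span_le.2 fun x hx => ?_)
    · rintro _ ⟨i, rfl⟩
      exact (b i).2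
    · rw [SetLike.mem_coe, hL] at hx
      obtain ⟨c, -, rfl⟩ := exists_coeff_of_mem_span hx
      exact sum_mem fun i _ => Submodule.smul_mem _ _ (Submodule.subset_span ⟨i, rfl⟩)
  refine isLattice_of_span_eq_top hL hb (le_antisymm ?_ ?_)
  · choose p hp hp0 hpw using fun i j => hw (b i) (b i).2 j
    let q : Fin r → polyRing k := fun i => ∏ j, ⟨p i j, hp i j⟩
    have hq0 : ∀ i, q i ≠ 0 := fun i => Finset.prod_ne_zero_iff.2 fun j _ h =>
      hp0 i j (congrArg Subtype.val h)
    have hq : ∀ i j, (q i : LaurentSeries k) * w.repr (b i) j ∈ polyRing k := by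
      intro i j
      simp only [q]
      rw [← Finset.prod_erase_mul _ _ (Finset.mem_univ j), Subring.coe_mul, mul_assoc]
      exact mul_mem (SetLike.coe_mem _) (hpw i j)
    have hbl : LinearIndependent (polyRing k) fun i => (b i : V) :=
      b.linearIndependent.map' L.subtype (Submodule.ker_subtype L)
    rw [Module.finrank_eq_card_basis w, Fintype.card_fin]
    refine card_le_of_smul_mem_span hbl w hq0 fun i => ?_
    have h1 : q i • (b i : V) = ∑ j, ((q i : LaurentSeries k) * w.repr (b i) j) • w j := by
      conv_lhs => rw [← w.sum_repr (b i : V), Finset.smul_sum]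
      exact Finset.sum_congr rfl fun j _ => (mul_smul _ _ _).symm
    rw [h1]
    exact sum_smul_mem _ (fun j => Submodule.subset_span (Set.mem_range_self j)) (hq i)
  · have h := finrank_range_le_card (R := LaurentSeries k) fun i => (b i : V)
    rwa [Set.finrank, hb, finrank_top, Fintype.card_fin] at h

variable {E : (P1 k).Modules} {d : ℕ} {θ : E.presheaf.stalk (genPt k) →+ V}

/-- The `A`-module of the values of the sections over the affine chart. -/
def chartLattice (hθ : IsSemilinear θ) : Submodule (polyRing k) V where
  carrier := Set.range (genVal θ genPt_mem_finChart)
  zero_mem' := ⟨0, map_zero _⟩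
  add_mem' := by
    rintro _ _ ⟨s, rfl⟩ ⟨t, rfl⟩
    exact ⟨s + t, map_add _ _ _⟩
  smul_mem' := by
    rintro ⟨c, hc⟩ _ ⟨s, rfl⟩
    rw [← range_expand_finChart] at hc
    obtain ⟨f, rfl⟩ := hc
    exact ⟨f • s, hθ.genVal_smul genPt_mem_finChart f s⟩

/-- The isomorphism of the functions on the affine chart with `A = k[T]`, as a ring homomorphism. -/
def expandPoly (k : Type u) [Field k] : Γ(P1 k, finChart k) →+* polyRing k :=
  (expand (finChart k) genPt_mem_finChart).codRestrict (polyRing k) fun f =>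
    range_expand_finChart (k := k) ▸ ⟨f, rfl⟩

/-- If the bundle is free on `D(g)`, then finitely many sections generate the `A`-module of
sections over the chart up to powers of `g`. -/
theorem exists_pow_smul_mem_span (hE : IsVectorBundle d E) (hθ : IsSemilinear θ)
    (hinj : Function.Injective θ) {g : Γ(P1 k, finChart k)} (hg : genPt k ∈ (P1 k).basicOpen g)
    {e : Fin d → Γ(E, (P1 k).basicOpen g)} (he : IsLocalBasis e) :
    ∃ m : Fin d → V, (∀ j, m j ∈ chartLattice hθ) ∧ ∀ x ∈ chartLattice hθ,
      ∃ N : ℕ, expandPoly k g ^ N • x ∈ Submodule.span (polyRing k) (Set.range m) := by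
  choose N t ht using fun j => exists_genVal_eq_pow_smul hE hθ hinj g hg (e j)
  refine ⟨fun j => genVal θ genPt_mem_finChart (t j), fun j => ⟨t j, rfl⟩, ?_⟩
  rintro _ ⟨s, rfl⟩
  have hle := (P1 k).basicOpen_le g
  obtain ⟨N', a, ha⟩ := exists_expand_eq_pow_mul isAffineOpen_finChart g hg genPt_mem_finChart
    (he.coord le_rfl (res E hle s))
  refine ⟨∑ j, N j + N', ?_⟩
  have h1 : expandPoly k g ^ (∑ j, N j + N') • genVal θ genPt_mem_finChart s =
      ∑ j, (expandPoly k g ^ (∑ j, N j - N j) * expandPoly k (a j)) •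
        genVal θ genPt_mem_finChart (t j) := by
    rw [← genVal_res hle hg s, hθ.genVal_eq_sum he le_rfl hg, Finset.smul_sum]
    refine Finset.sum_congr rfl fun j _ => ?_
    have h2 : N j ≤ ∑ j, N j := Finset.single_le_sum (fun _ _ => Nat.zero_le _) (Finset.mem_univ j)
    rw [ht j, Subring.smul_def, Subring.smul_def, ← mul_smul, ← mul_smul]
    congr 1
    change expand _ _ g ^ _ * _ = expand _ _ g ^ _ * expand _ _ (a j) * _
    rw [ha j, pow_add]
    nth_rewrite 1 [← Nat.sub_add_cancel h2]
    rw [pow_add]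
    ring
  rw [h1]
  exact sum_mem fun j _ => Submodule.smul_mem _ _ (Submodule.subset_span ⟨j, rfl⟩)

theorem fg_chartLattice (hE : IsVectorBundle d E) (hθ : IsSemilinear θ)
    (hinj : Function.Injective θ) : (chartLattice hθ).FG := by
  obtain ⟨t, ht, hbasis⟩ := hE.exists_finset
  have h : ∀ g ∈ t, ∃ m : Fin d → V, (∀ j, m j ∈ chartLattice hθ) ∧ ∀ x ∈ chartLattice hθ,
      ∃ N : ℕ, expandPoly k g ^ N • x ∈ Submodule.span (polyRing k) (Set.range m) := by
    intro g hg
    obtain ⟨hηg, e, he⟩ := hbasis g hg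
    exact exists_pow_smul_mem_span hE hθ hinj hηg he
  choose! m hm hmN using h
  let S : Set V := ⋃ g ∈ t, Set.range (m g)
  have hS : S.Finite := t.finite_toSet.biUnion fun g _ => Set.finite_range _
  have hspan : Ideal.span (expandPoly k '' t) = ⊤ := by
    rw [← Ideal.map_span, ht, Ideal.map_top]
  refine ⟨hS.toFinset, le_antisymm ?_ fun x hx => ?_⟩
  · rw [Submodule.span_le, hS.coe_toFinset]
    intro x hx
    obtain ⟨g, hg, j, rfl⟩ := by simpa [S] using hx
    exact hm g hg j
  · refine Submodule.mem_of_span_eq_top_of_smul_pow_mem _ _ hspan x ?_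
    rintro ⟨_, g, hg, rfl⟩
    obtain ⟨N, hN⟩ := hmN g hg x hx
    refine ⟨N, Submodule.span_mono ?_ hN⟩
    rw [hS.coe_toFinset]
    exact Set.subset_biUnion_of_mem (u := fun g => Set.range (m g)) hg

/-- A local basis at `∞` gives an embedding of the generic stalk into `K_∞ ^ d` for which the
sections over the affine chart form a lattice, and the completed stalk at `∞` is the standard
lattice. -/
theorem IsVectorBundle.exists_isAssociated (hE : IsVectorBundle d E) :
    ∃ (L : Submodule (polyRing k) (Fin d → LaurentSeries k))
      (M : Submodule (intRing k) (Fin d → LaurentSeries k)),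
      IsLattice L ∧ IsLattice M ∧ IsAssociated E L M := by
  obtain ⟨U, hU, e, he⟩ := hE.exists_isLocalBasis (inftyPt k)
  have hη := genPt_mem U _ hU
  have hd : Module.finrank (LaurentSeries k) (Fin d → LaurentSeries k) = d :=
    Module.finrank_fin_fun _
  let w := Pi.basisFun (LaurentSeries k) (Fin d)
  let θ := he.frameMap hη w
  have hθ : IsSemilinear θ := he.isSemilinear_frameMap hη w
  have hinj : Function.Injective θ := he.frameMap_injective hη w.linearIndependent
  have hval : ∀ i, genVal θ hη (e i) = w i := he.genVal_frameMap_self hη w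
  refine ⟨chartLattice hθ, Submodule.span (intRing k) (Set.range w), ?_, ?_, ?_⟩
  · refine isLattice_of_fg (fg_chartLattice hE hθ hinj) ?_ w ?_
    · rw [eq_top_iff, ← w.span_eq, Submodule.span_le]
      rintro _ ⟨j, rfl⟩
      obtain ⟨f, hfU, hf⟩ := isAffineOpen_finChart.exists_basicOpen_le ⟨genPt k, hη⟩
        genPt_mem_finChart
      obtain ⟨N, t, ht⟩ := exists_genVal_eq_pow_smul hE hθ hinj f hf (res E hfU (e j))
      have hf0 : expand _ genPt_mem_finChart f ≠ 0 := by
        have hunit : IsUnit (resFun ((P1 k).basicOpen_le f) f) :=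
          RingedSpace.isUnit_res_basicOpen _ f
        exact (hunit.map (expand _ hf)).ne_zero
      rw [genVal_res hfU hf, hval] at ht
      have h1 : w j = (expand _ genPt_mem_finChart f ^ N)⁻¹ • genVal θ genPt_mem_finChart t := by
        rw [ht, inv_smul_smul₀ (pow_ne_zero N hf0)]
      rw [SetLike.mem_coe, h1]
      exact Submodule.smul_mem _ _ (Submodule.subset_span ⟨t, rfl⟩)
    · rintro _ ⟨s, rfl⟩ j
      have hη' : genPt k ∈ finChart k ⊓ U := ⟨genPt_mem_finChart, hη⟩
      have h1 := he.genVal_frameMap hη w inf_le_right hη' (res E inf_le_left s)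
      rw [← genVal_res inf_le_left hη' s]
      change ∃ p ∈ polyRing k, p ≠ 0 ∧ p * w.repr (genVal (he.frameMap hη w) _ _) j ∈ _
      rw [h1, w.repr_sum_self]
      exact exists_mul_expand_mem_polyRing hη' _
  · exact isLattice_of_span_eq_top rfl (w.span_eq) hd.symm
  · refine ⟨hd.symm ▸ hE, θ, hinj, hθ, rfl, ?_⟩
    rw [span_stalk_inftyPt hθ he hU]
    exact congrArg _ (congrArg Set.range (funext fun i => (hval i).symm))

end LatticesOfBundle

end SplitP1
end

open SplitP1 in
theorem theorem1 (k : Type u) [Field k] :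
    (∀ (V : Type v) [AddCommGroup V] [Module (LaurentSeries k) V]
        [Module.Finite (LaurentSeries k) V] (d : ℕ)
        (_ : Module.finrank (LaurentSeries k) V = d)
        (L : Submodule (polyRing k) V) (M : Submodule (intRing k) V),
        IsLattice L → IsLattice M →
      (∃ (v : Fin d → V) (n : Fin d → ℤ), IsAdapted L M v n) ∧
      (∀ (v v' : Fin d → V) (n n' : Fin d → ℤ), IsAdapted L M v n → IsAdapted L M v' n' →
        ∃ σ : Equiv.Perm (Fin d), ∀ i, n' i = n (σ i)) ∧
      (∃ E : (P1 k).Modules, IsAssociated E L M) ∧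
      (∀ (E : (P1 k).Modules) (v : Fin d → V) (n : Fin d → ℤ),
        IsAssociated E L M → IsAdapted L M v n →
          Nonempty (E ≅ sumTwist k n))) ∧
    (∀ (d : ℕ) (E : (P1 k).Modules), IsVectorBundle d E →
      (∃ (L : Submodule (polyRing k) (Fin d → LaurentSeries k))
        (M : Submodule (intRing k) (Fin d → LaurentSeries k)),
        IsLattice L ∧ IsLattice M ∧ IsAssociated E L M) ∧
      (∃ n : Fin d → ℤ, Nonempty (E ≅ sumTwist k n))) := by
  refine ⟨fun V _ _ _ d hd L M hL hM => ?_, fun d E hE => ?_⟩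
  · have hadapted : ∃ (v : Fin d → V) (n : Fin d → ℤ), IsAdapted L M v n :=
      hd ▸ exists_isAdapted hL hM
    obtain ⟨v, n, h⟩ := hadapted
    exact ⟨⟨v, n, h⟩, fun _ _ _ _ h h' => h.exists_perm h',
      ⟨_, h.isAssociated_sumTwist hd⟩,
      fun E v n hE h => hE.nonempty_iso hM (h.isAssociated_sumTwist hd)⟩
  · obtain ⟨L, M, hL, hM, hEass⟩ := hE.exists_isAssociated
    have hd : Module.finrank (LaurentSeries k) (Fin d → LaurentSeries k) = d :=
      Module.finrank_fin_fun _
    have hadapted : ∃ (v : Fin d → Fin d → LaurentSeries k) (n : Fin d → ℤ), IsAdapted L M v n := by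
      have h := exists_isAdapted hL hM
      rwa [hd] at h
    obtain ⟨v, n, h⟩ := hadapted
    exact ⟨⟨L, M, hL, hM, hEass⟩, n,
      IsAssociated.nonempty_iso hM hEass (h.isAssociated_sumTwist hd)⟩
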